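/- For $n\ge 1$, an $\alpha/\beta$-staircase tableau of size $n$ is a filling of the boxes of the Young diagram of shape $(n,n-1,\dots,1)$, whose rows and columns are numbered from the north-west corner, such that each box is empty or contains one symbol $\alpha$ or $\beta$, and such that: every box $(i,j)$ with $i+j=n+1$ contains a symbol; all boxes in the same column as and north of an $\alpha$ are empty; all boxes in the same row as and west of a $\beta$ are empty. Let $\mathcal S_n$ be the set of these tableaux. For real $\alpha,\beta>0$, let $\mathrm{wt}(S)$ be the product of all symbols in $S\in\mathcal S_n$, and let $$\mathbb P_{n,\alpha,\beta}(S)=\frac{\mathrm{wt}(S)}{\sum_{T\in\mathcal S_n}\mathrm{wt}(T)},\qquad S\in\mathcal S_n .$$ The definition is extended to infinite parameters by taking pointwise limits: $\mathbb P_{n,\infty,\beta}=\lim_{t\to\infty}\mathbb P_{n,t,\beta}$, $\mathbb P_{n,\alpha,\infty}=\lim_{t\to\infty}\mathbb P_{n,\alpha,t}$ and $\mathbb P_{n,\infty,\infty}=\lim_{t\to\infty}\mathbb P_{n,t,t}$. The $k$-th diagonal consists of the boxes $(i,j)$ with $i+j=n-k+2$. **Theorem.** Fix an integer $k>1$ and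 parameters $\alpha,\beta\in(0,\infty]$. Let $A_n^{(k)}$ be the number of $\alpha$'s on the $k$-th diagonal of a random tableau in $\mathcal S_n$ with law $\mathbb P_{n,\alpha,\beta}$. Then, as $n\to\infty$, $A_n^{(k)}$ converges in distribution to a Poisson random variable with parameter $\tfrac12$. -/

import Mathlib

open scoped NNReal ENNReal

/-- The two symbols of an `α/β`-staircase tableau. -/
inductive StairSymbol : Type
  | alpha
  | beta

/-- An `α/β`-staircase tableau of size `n`: a filling of the Young diagram of shape
`(n, n - 1, …, 1)`. Rows and columns are numbered from the north-west corner, starting from `0`,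
so that the boxes are the positions `(i, j)` with `i + j < n` and the first diagonal consists of the
boxes with `i + j + 1 = n`. `entry i j = none` means that the box is empty; positions outside
the diagram carry no symbol. -/
@[ext]
structure StaircaseTableau (n : ℕ) where
  entry : Fin n → Fin n → Option StairSymbol
  outside : ∀ i j : Fin n, n ≤ (i : ℕ) + (j : ℕ) → entry i j = none
  first_diagonal : ∀ i j : Fin n, (i : ℕ) + (j : ℕ) + 1 = n → entry i j ≠ none
  north_of_alpha : ∀ i i' j : Fin n,
    entry i j = some StairSymbol.alpha → i' < i → entry i' j = none
  west_of_beta : ∀ i j j' : Fin n,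
    entry i j = some StairSymbol.beta → j' < j → entry i j' = none

namespace StaircaseTableau

noncomputable section

instance : Finite StairSymbol :=
  Finite.of_injective (fun x : StairSymbol => match x with | .alpha => true | .beta => false)
    (by rintro (_ | _) (_ | _) h <;> simp_all)

instance (n : ℕ) : Finite (StaircaseTableau n) :=
  Finite.of_injective (fun S : StaircaseTableau n => S.entry) (fun _ _ h => StaircaseTableau.ext h)

instance (n : ℕ) : Fintype (StaircaseTableau n) := Fintype.ofFinite _

instance (n : ℕ) : MeasurableSpace (StaircaseTableau n) := ⊤

instance (n : ℕ) : DiscreteMeasurableSpace (StaircaseTableau n) := ⟨fun _ => trivial⟩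

variable {n : ℕ}

/-- The number of occurrences of the symbol `x` in `S`. -/
def count (S : StaircaseTableau n) (x : StairSymbol) : ℕ :=
  {p : Fin n × Fin n | S.entry p.1 p.2 = some x}.ncard

/-- The number of occurrences of the symbol `x` on the `k`-th diagonal of `S`. With rows and columns
numbered from `1`, the `k`-th diagonal is `i + j = n - k + 2`; numbered from `0`, as here, it is
`i + j + k = n`. -/
def diagCount (S : StaircaseTableau n) (k : ℕ) (x : StairSymbol) : ℕ :=
  {p : Fin n × Fin n | (p.1 : ℕ) + (p.2 : ℕ) + k = n ∧ S.entry p.1 p.2 = some x}.ncard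

/-- The weight of `S`: the product of all its symbols. -/
def weight (α β : ℝ≥0) (S : StaircaseTableau n) : ℝ≥0 :=
  α ^ S.count .alpha * β ^ S.count .beta

/-- The partition function `Z_n(α, β)`. -/
def partitionFunction (n : ℕ) (α β : ℝ≥0) : ℝ≥0 :=
  ∑ S : StaircaseTableau n, S.weight α β

/-- The probability `wt(S) / Z_n(α, β)` of `S`, for finite parameters. -/
def prob (α β : ℝ≥0) (S : StaircaseTableau n) : ℝ≥0 :=
  S.weight α β / partitionFunction n α β

/-- A finite parameter is kept, an infinite parameter is replaced by `t`. -/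
def param (x : ℝ≥0∞) (t : ℝ≥0) : ℝ≥0 := if x = ∞ then t else x.toNNReal

/-- The probability of `S` for parameters in `[0, ∞]`: the infinite parameters are replaced by a
common finite value `t`, and then `t → ∞`. If both parameters are finite, this is the limit of
a constant. (The limit exists, see `tendsto_prob_param`.) -/
def extProb (α β : ℝ≥0∞) (S : StaircaseTableau n) : ℝ≥0 :=
  Filter.limUnder Filter.atTop (fun t : ℝ≥0 => S.prob (param α t) (param β t))

/-- The tableau with the same symbol `x` everywhere on the first diagonal and all other boxes
empty. -/
def diagonalTableau (n : ℕ) (x : StairSymbol) : StaircaseTableau n where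
  entry i j := if (i : ℕ) + (j : ℕ) + 1 = n then some x else none
  outside i j h := if_neg (by omega)
  first_diagonal i j h := by simp [h]
  north_of_alpha i i' j h hi := by
    have : (i : ℕ) + (j : ℕ) + 1 = n := by by_contra h'; simp [h'] at h
    exact if_neg (by have : (i' : ℕ) < i := hi; omega)
  west_of_beta i j j' h hj := by
    have : (i : ℕ) + (j : ℕ) + 1 = n := by by_contra h'; simp [h'] at h
    exact if_neg (by have : (j' : ℕ) < j := hj; omega)

theorem count_diagonalTableau {x y : StairSymbol} (h : x ≠ y) :
    (diagonalTableau n x).count y = 0 := by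
  simp [count, diagonalTableau, h]

theorem tendsto_nnreal_inv :
    Filter.Tendsto (fun t : ℝ≥0 => t⁻¹) Filter.atTop (nhds 0) := by
  rw [← NNReal.tendsto_coe]
  simpa [Function.comp_def] using (tendsto_inv_atTop_zero (𝕜 := ℝ)).comp
    (NNReal.tendsto_coe_atTop.2 Filter.tendsto_id)

theorem exists_tendsto_ratio {ι : Type*} [Fintype ι] (c : ι → ℝ≥0) (e : ι → ℕ)
    (hc : ∃ i, c i ≠ 0) (i : ι) :
    ∃ l, Filter.Tendsto (fun t : ℝ≥0 => c i * t ^ e i / ∑ j, c j * t ^ e j)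
      Filter.atTop (nhds l) := by
  classical
  obtain ⟨i₀, hi₀, hmax⟩ := Finset.exists_max_image (Finset.univ.filter fun i => c i ≠ 0) e
    (by obtain ⟨j, hj⟩ := hc; exact ⟨j, by simpa using hj⟩)
  simp only [Finset.mem_filter, Finset.mem_univ, true_and] at hi₀ hmax
  have hlim : ∀ j, Filter.Tendsto (fun t : ℝ≥0 => c j * (t⁻¹) ^ (e i₀ - e j)) Filter.atTop
      (nhds (c j * 0 ^ (e i₀ - e j))) := fun j =>
    ((tendsto_nnreal_inv.pow _).const_mul _)
  refine ⟨_, ((hlim i).div (tendsto_finsetSum Finset.univ fun j _ => hlim j) ?_).congr' ?_⟩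
  · intro h
    have := (Finset.sum_eq_zero_iff.1 h) i₀ (Finset.mem_univ _)
    simp [hi₀] at this
  · filter_upwards [Filter.eventually_gt_atTop 0] with t ht
    have key : ∀ j, c j * (t⁻¹) ^ (e i₀ - e j) = c j * t ^ e j * (t ^ e i₀)⁻¹ := by
      intro j
      by_cases hj : c j = 0
      · simp [hj]
      · obtain ⟨d, hd⟩ := Nat.exists_eq_add_of_le (hmax j hj)
        rw [hd, Nat.add_sub_cancel_left, inv_pow, pow_add]
        field_simp
    simp only [Pi.div_apply, key]
    rw [← Finset.sum_mul, mul_div_mul_right _ _ (inv_ne_zero (pow_ne_zero _ ht.ne'))]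

theorem exists_weight_param (α β : ℝ≥0∞) (h : α ≠ 0 ∨ β ≠ 0) :
    ∃ (c : StaircaseTableau n → ℝ≥0) (e : StaircaseTableau n → ℕ), (∃ S, c S ≠ 0) ∧
      ∀ S t, S.weight (param α t) (param β t) = c S * t ^ e S := by
  refine ⟨fun S => (if α = ∞ then 1 else α.toNNReal ^ S.count .alpha) *
      (if β = ∞ then 1 else β.toNNReal ^ S.count .beta),
    fun S => (if α = ∞ then S.count .alpha else 0) + (if β = ∞ then S.count .beta else 0), ?_, ?_⟩
  · rcases h with h | h
    · refine ⟨diagonalTableau n .alpha, ?_⟩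
      beta_reduce
      rw [count_diagonalTableau (x := .alpha) (y := .beta) (by simp)]
      by_cases hα : α = ∞ <;> simp [hα, h, ENNReal.toNNReal_eq_zero_iff]
    · refine ⟨diagonalTableau n .beta, ?_⟩
      beta_reduce
      rw [count_diagonalTableau (x := .beta) (y := .alpha) (by simp)]
      by_cases hβ : β = ∞ <;> simp [hβ, h, ENNReal.toNNReal_eq_zero_iff]
  · intro S t
    by_cases hα : α = ∞ <;> by_cases hβ : β = ∞ <;>
      simp [weight, param, hα, hβ, pow_add, mul_comm]

theorem tendsto_prob_param (α β : ℝ≥0∞) (h : α ≠ 0 ∨ β ≠ 0) (S : StaircaseTableau n) :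
    Filter.Tendsto (fun t : ℝ≥0 => S.prob (param α t) (param β t)) Filter.atTop
      (nhds (S.extProb α β)) := by
  obtain ⟨c, e, hc, hw⟩ := exists_weight_param (n := n) α β h
  refine tendsto_nhds_limUnder ?_
  simpa only [prob, partitionFunction, hw] using exists_tendsto_ratio c e hc S

theorem partitionFunction_ne_zero (α β : ℝ≥0) (h : α ≠ 0 ∨ β ≠ 0) :
    partitionFunction n α β ≠ 0 := by
  intro h0
  have hall := Finset.sum_eq_zero_iff.1 h0
  rcases h with h | h
  · have := hall (diagonalTableau n .alpha) (Finset.mem_univ _)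
    rw [weight, count_diagonalTableau (x := .alpha) (y := .beta) (by simp)] at this
    simp [h] at this
  · have := hall (diagonalTableau n .beta) (Finset.mem_univ _)
    rw [weight, count_diagonalTableau (x := .beta) (y := .alpha) (by simp)] at this
    simp [h] at this

theorem sum_prob (α β : ℝ≥0) (h : α ≠ 0 ∨ β ≠ 0) :
    ∑ S : StaircaseTableau n, S.prob α β = 1 := by
  simp only [prob]
  rw [← Finset.sum_div]
  exact div_self (partitionFunction_ne_zero α β h)

theorem param_ne_zero {x : ℝ≥0∞} (hx : x ≠ 0) {t : ℝ≥0} (ht : 0 < t) : param x t ≠ 0 := by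
  by_cases h : x = ∞ <;> simp [param, h, hx, ht.ne', ENNReal.toNNReal_eq_zero_iff]

theorem sum_extProb (α β : ℝ≥0∞) (h : α ≠ 0 ∨ β ≠ 0) :
    ∑ S : StaircaseTableau n, S.extProb α β = 1 := by
  refine tendsto_nhds_unique (tendsto_finsetSum Finset.univ
    fun S _ => tendsto_prob_param (n := n) α β h S) ?_
  refine tendsto_const_nhds.congr' ?_
  filter_upwards [Filter.eventually_gt_atTop 0] with t ht
  exact (sum_prob _ _ (h.imp (fun h => param_ne_zero h ht) (fun h => param_ne_zero h ht))).symm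

theorem extProb_coe (α β : ℝ≥0) (S : StaircaseTableau n) :
    S.extProb (α : ℝ≥0∞) (β : ℝ≥0∞) = S.prob α β := by
  simpa [extProb, param] using (tendsto_const_nhds (x := S.prob α β)
    (f := (Filter.atTop : Filter ℝ≥0))).limUnder_eq

/-- The law of the random weighted `α/β`-staircase tableau of size `n`, for parameters
`α, β ∈ [0, ∞]`, not both zero. -/
def law (n : ℕ) (α β : ℝ≥0∞) (h : α ≠ 0 ∨ β ≠ 0) : PMF (StaircaseTableau n) :=
  PMF.ofFintype (fun S => (S.extProb α β : ℝ≥0∞)) (by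
    rw [← ENNReal.ofNNReal_finsetSum, sum_extProb α β h, ENNReal.coe_one])

/-- For finite parameters, the law is `S ↦ wt(S) / Z_n(α, β)`. -/
theorem law_coe (n : ℕ) (α β : ℝ≥0) (h : (α : ℝ≥0∞) ≠ 0 ∨ (β : ℝ≥0∞) ≠ 0)
    (S : StaircaseTableau n) : law n α β h S = (S.prob α β : ℝ≥0∞) := by
  rw [law, PMF.ofFintype_apply, extProb_coe]

end

end StaircaseTableau

/-! ### Weighted sums over a single column -/

namespace StaircaseTableau

noncomputable section

open Finset Classical

/-! Let `a`, `b` be the reciprocals of the parameters, `N = a + b + n`, and let `G` be the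
probability generating function `diagGen`. Remove the first column. The columns that fit in front of
a given tail have total weight proportional to `(1 + 1/b) ^ r`, where `r` is the number of β-free
rows of the tail. A row holds at most one β, so this factor merely turns `b` into `b + 1`: the tail
is a random tableau with parameters `a`, `b + 1` (`mean_tail`).

The removed column meets the diagonal in one box. An α there empties the boxes above it and leaves
boundedly many below, so this event needs a β-free row in the tail and costs a further factor of
about `1/N` (`mean_hasAlpha`). The row is β-free with probability about `b/N`, almost independently
of the diagonal count in a still smaller tableau (`norm_freeGen_sub_le`). Hence, up to `O(1/N²)`,
removing a column changes `G` by `(1 - z) b/N²` times `G` at a nearby point (`norm_diagGen_sub_le`).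

The step `n → n - 1`, `b → b + 1` keeps `N` and moves `u = b/N` by `1/N`. The recursion is thus an
Euler scheme for `G' = (1 - z) u G` with `G = 1` at `u = 1`, whose solution is `exp (-(1 - z) (1 -
u²) / 2)`. The errors of at most `N` steps add up to `O(1/N)` (`norm_diagGen_sub_limitGen_le`). For
bounded `b`, `u` tends to `0` and the Poisson generating function appears, the parameter being the
integral of `u` over `[0, 1]`.

All bounds are uniform for `a`, `b` in a bounded interval `(0, M]`, so they survive the passage to
infinite parameters (`exists_norm_sum_extProb_sub_exp_le`). Lévy's continuity theorem finishes the
proof (`tendstoInDistribution_nat_of_charFun`). -/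

instance : Fintype StairSymbol := Fintype.ofFinite _

/-- The weight of a single box. -/
def boxWeight (x y : ℝ) : Option StairSymbol → ℝ
  | none => 1
  | some .alpha => x
  | some .beta => y

/-- `c` can be put in front of a tableau of size `n` whose `β`-free rows are given by `R`. -/
def IsColumn {n : ℕ} (R : Fin n → Prop) (c : Fin (n + 1) → Option StairSymbol) : Prop :=
  c (Fin.last n) ≠ none ∧ (∀ i i', c i = some .alpha → i' < i → c i' = none) ∧
    ∀ i : Fin n, c i.castSucc ≠ none → R i

/-- The sum over all columns of the products of the box weights `g`. -/
def colSum {n : ℕ} (R : Fin n → Prop) (g : Fin (n + 1) → Option StairSymbol → ℝ) : ℝ :=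
  ∑ c : Fin (n + 1) → Option StairSymbol, if IsColumn R c then ∏ i, g i (c i) else 0

/-- The box weights `g` with the symbol `α` forbidden. -/
def noAlpha {n : ℕ} (g : Fin (n + 1) → Option StairSymbol → ℝ) :
    Fin (n + 1) → Option StairSymbol → ℝ :=
  fun i e => if e = some .alpha then 0 else g i e

theorem sum_option_stairSymbol {M : Type*} [AddCommMonoid M] (f : Option StairSymbol → M) :
    ∑ e, f e = f none + (f (some .alpha) + f (some .beta)) := by
  have h : (univ : Finset StairSymbol) = {.alpha, .beta} := by
    ext s; cases s <;> simp
  rw [Fintype.sum_option, h, Finset.sum_pair (by simp)]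

/-- Boxes north of an α are empty, so the top box interacts with the rest of the column only by
excluding α's below it once it is filled. This drives all later inductions on columns. -/
theorem isColumn_cons {n : ℕ} (R : Fin (n + 1) → Prop) (e : Option StairSymbol)
    (c : Fin (n + 1) → Option StairSymbol) :
    IsColumn R (Fin.cons e c : Fin (n + 2) → Option StairSymbol) ↔
      IsColumn (fun i => R i.succ) c ∧
        (e ≠ none → R 0 ∧ ∀ i, c i ≠ some .alpha) := by
  unfold IsColumn
  have hl : (Fin.last (n + 1)) = (Fin.last n).succ := (Fin.succ_last n).symm
  constructor
  · rintro ⟨h1, h2, h3⟩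
    rw [hl, Fin.cons_succ] at h1
    refine ⟨⟨h1, fun i i' hi hii => ?_, fun i hi => ?_⟩, fun he => ⟨?_, ?_⟩⟩
    · simpa using h2 i.succ i'.succ (by simpa using hi) (by simpa using hii)
    · exact h3 i.succ (by simpa [← Fin.succ_castSucc] using hi)
    · exact h3 0 (by simpa using he)
    · intro i hi
      exact he (by simpa using h2 i.succ 0 (by simpa using hi) (Fin.succ_pos i))
  · rintro ⟨⟨h1, h2, h3⟩, h4⟩
    refine ⟨by rwa [hl, Fin.cons_succ], fun i => ?_, fun i => ?_⟩
    · refine Fin.cases (fun i' _ h => absurd h (Fin.not_lt_zero i')) (fun i i' => ?_) i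
      refine Fin.cases (fun hi _ => ?_) (fun i' hi hii => ?_) i'
      · by_contra he
        exact (h4 (by simpa using he)).2 i (by simpa using hi)
      · simpa using h2 i i' (by simpa using hi) (by simpa using hii)
    · refine Fin.cases (fun hi => (h4 (by simpa using hi)).1) (fun i hi => h3 i ?_) i
      simpa [← Fin.succ_castSucc] using hi

theorem prod_noAlpha {n : ℕ} (g : Fin (n + 1) → Option StairSymbol → ℝ)
    (c : Fin (n + 1) → Option StairSymbol) :
    ∏ i, noAlpha g i (c i) = if ∀ i, c i ≠ some .alpha then ∏ i, g i (c i) else 0 := by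
  split_ifs with h
  · exact Finset.prod_congr rfl fun i _ => if_neg (h i)
  · push Not at h
    obtain ⟨i, hi⟩ := h
    exact Finset.prod_eq_zero (Finset.mem_univ i) (if_pos hi)

theorem colSum_zero (R : Fin 0 → Prop) (g : Fin 1 → Option StairSymbol → ℝ) :
    colSum R g = g 0 (some .alpha) + g 0 (some .beta) := by
  unfold colSum
  rw [← (Equiv.funUnique (Fin 1) (Option StairSymbol)).symm.sum_comp, sum_option_stairSymbol]
  have h : ∀ e : Option StairSymbol, IsColumn R
      ((Equiv.funUnique (Fin 1) (Option StairSymbol)).symm e) ↔ e ≠ none := by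
    intro e
    simp only [IsColumn]
    refine ⟨fun h => h.1, fun h => ⟨h, fun i i' _ hi => ?_, fun i => i.elim0⟩⟩
    exact absurd hi (by simp)
  simp only [h]
  simp [uniqueElim_const]

theorem colSum_succ {n : ℕ} (R : Fin (n + 1) → Prop)
    (g : Fin (n + 2) → Option StairSymbol → ℝ) :
    colSum R g = g 0 none * colSum (fun i => R i.succ) (fun i => g i.succ) +
      if R 0 then (g 0 (some .alpha) + g 0 (some .beta)) *
        colSum (fun i => R i.succ) (noAlpha fun i => g i.succ) else 0 := by
  have hkey : ∀ (e : Option StairSymbol) (c : Fin (n + 1) → Option StairSymbol),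
      (if IsColumn R (Fin.cons e c : Fin (n + 2) → Option StairSymbol) then
        ∏ i, g i ((Fin.cons e c : Fin (n + 2) → Option StairSymbol) i) else 0) =
      if e = none then g 0 none * (if IsColumn (fun i => R i.succ) c then
        ∏ i, g (Fin.succ i) (c i) else 0)
      else if R 0 then g 0 e * (if IsColumn (fun i => R i.succ) c then
        ∏ i, noAlpha (fun i => g i.succ) i (c i) else 0) else 0 := by
    intro e c
    rw [isColumn_cons, Fin.prod_univ_succ]
    simp only [prod_noAlpha, Fin.cons_zero, Fin.cons_succ]
    by_cases he : e = none
    · subst he; simp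
    · by_cases h0 : R 0 <;> by_cases hc : IsColumn (fun i => R i.succ) c <;>
        by_cases ha : ∀ i, c i ≠ some .alpha <;> simp [he, h0, hc, ha]
  unfold colSum
  rw [← (Fin.consEquiv fun _ : Fin (n + 2) => Option StairSymbol).sum_comp,
    Fintype.sum_prod_type]
  refine (Fintype.sum_congr _ _ fun e => Fintype.sum_congr _ _ fun c => hkey e c).trans ?_
  rw [sum_option_stairSymbol]
  simp only [if_true, Finset.mul_sum, reduceCtorEq, if_false]
  split_ifs with h0
  · simp only [← Finset.sum_add_distrib, add_mul]
  · simp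

theorem noAlpha_succ {n : ℕ} (g : Fin (n + 2) → Option StairSymbol → ℝ) :
    (fun i : Fin (n + 1) => noAlpha g i.succ) = noAlpha fun i => g i.succ := rfl

theorem noAlpha_noAlpha {n : ℕ} (g : Fin (n + 1) → Option StairSymbol → ℝ) :
    noAlpha (noAlpha g) = noAlpha g := by
  ext i e; simp only [noAlpha]; split_ifs <;> rfl

/-- Without α the boxes are independent: the bottom box must be β, and every other box is empty or,
in an allowed row, β. -/
theorem colSum_noAlpha {n : ℕ} (R : Fin n → Prop) (g : Fin (n + 1) → Option StairSymbol → ℝ) :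
    colSum R (noAlpha g) = g (Fin.last n) (some .beta) *
      ∏ i : Fin n, (g i.castSucc none + if R i then g i.castSucc (some .beta) else 0) := by
  induction n with
  | zero => simp [colSum_zero, noAlpha]
  | succ n ih =>
    rw [colSum_succ, noAlpha_succ, noAlpha_noAlpha, ih, Fin.prod_univ_succ]
    simp only [noAlpha, Fin.succ_last, Fin.castSucc_zero, Fin.castSucc_succ, reduceCtorEq, if_false,
      if_true, Option.some.injEq]
    split_ifs <;> ring

/-- The product of a factor `1 + y` for every row of `R`. -/
def rowFactor {n : ℕ} (R : Fin n → Prop) (y : ℝ) : ℝ := ∏ i, if R i then 1 + y else 1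

theorem rowFactor_succ {n : ℕ} (R : Fin (n + 1) → Prop) (y : ℝ) :
    rowFactor R y = (if R 0 then 1 + y else 1) * rowFactor (fun i => R i.succ) y :=
  Fin.prod_univ_succ _

theorem colSum_noAlpha_boxWeight {n : ℕ} (R : Fin n → Prop) (x y : ℝ) :
    colSum R (noAlpha fun _ => boxWeight x y) = y * rowFactor R y := by
  rw [colSum_noAlpha, rowFactor]
  congr 1
  refine Finset.prod_congr rfl fun i _ => ?_
  split_ifs <;> simp [boxWeight]

theorem colSum_boxWeight {n : ℕ} (R : Fin n → Prop) (x y : ℝ) :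
    colSum R (fun _ => boxWeight x y) = (x + y) * rowFactor R y := by
  induction n with
  | zero => simp [colSum_zero, boxWeight, rowFactor]
  | succ n ih =>
    rw [colSum_succ, ih, colSum_noAlpha_boxWeight, rowFactor_succ]
    simp only [boxWeight]
    split_ifs <;> ring

/-- The box weights restricted to columns with an `α` in row `ρ`. -/
def alphaAt {n : ℕ} (x y : ℝ) (ρ : ℕ) : Fin (n + 1) → Option StairSymbol → ℝ :=
  fun i e => boxWeight x y e * if (i : ℕ) = ρ then (if e = some .alpha then 1 else 0) else 1

/-- The box weights restricted to columns without a `β` in row `ρ`. -/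
def notBetaAt {n : ℕ} (x y : ℝ) (ρ : ℕ) : Fin (n + 1) → Option StairSymbol → ℝ :=
  fun i e => boxWeight x y e * if (i : ℕ) = ρ then (if e = some .beta then 0 else 1) else 1

theorem alphaAt_succ {n : ℕ} (x y : ℝ) (ρ : ℕ) :
    (fun i : Fin (n + 1) => alphaAt x y (ρ + 1) i.succ) = alphaAt x y ρ := by
  ext i e; simp [alphaAt]

theorem notBetaAt_succ {n : ℕ} (x y : ℝ) (ρ : ℕ) :
    (fun i : Fin (n + 1) => notBetaAt x y (ρ + 1) i.succ) = notBetaAt x y ρ := by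
  ext i e; simp [notBetaAt]

theorem alphaAt_zero_succ {n : ℕ} (x y : ℝ) :
    (fun i : Fin (n + 1) => alphaAt x y 0 i.succ) = fun _ => boxWeight x y := by
  ext i e; simp [alphaAt]

theorem notBetaAt_zero_succ {n : ℕ} (x y : ℝ) :
    (fun i : Fin (n + 1) => notBetaAt x y 0 i.succ) = fun _ => boxWeight x y := by
  ext i e; simp [notBetaAt]

theorem colSum_noAlpha_alphaAt {n : ℕ} (R : Fin n → Prop) (x y : ℝ) {ρ : ℕ} (hρ : ρ ≤ n) :
    colSum R (noAlpha (alphaAt x y ρ)) = 0 := by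
  rw [colSum]
  refine Finset.sum_eq_zero fun c _ => ?_
  split_ifs with h
  · refine Finset.prod_eq_zero (Finset.mem_univ ⟨ρ, by omega⟩) ?_
    simp only [noAlpha, alphaAt]
    split_ifs <;> simp_all
  · rfl

theorem colSum_alphaAt_last {n : ℕ} (R : Fin n → Prop) (x y : ℝ) :
    colSum R (alphaAt x y n) = x := by
  induction n with
  | zero => simp [colSum_zero, alphaAt, boxWeight]
  | succ n ih =>
    rw [colSum_succ, alphaAt_succ, ih, colSum_noAlpha_alphaAt _ _ _ le_rfl]
    simp [alphaAt, boxWeight]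

/-- The α empties everything above it and excludes α below it. Below, the allowed rows choose freely
between empty and β, and the bottom box is forced to be β, whence the factor `y`. -/
theorem colSum_alphaAt {n : ℕ} (R : Fin n → Prop) (x y : ℝ) (ρ : Fin n) :
    colSum R (alphaAt x y ρ) =
      if R ρ then x * y * rowFactor (fun i => ρ < i ∧ R i) y else 0 := by
  induction n with
  | zero => exact ρ.elim0
  | succ n ih =>
    refine Fin.cases ?_ (fun ρ => ?_) ρ
    · rw [colSum_succ, Fin.val_zero, alphaAt_zero_succ, colSum_boxWeight, colSum_noAlpha_boxWeight,
        rowFactor_succ]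
      simp only [alphaAt, boxWeight, Fin.succ_pos, true_and, lt_self_iff_false, false_and]
      split_ifs <;> simp_all
      ring
    · rw [colSum_succ, Fin.val_succ, alphaAt_succ, ih, colSum_noAlpha_alphaAt _ _ _ (by omega),
        rowFactor_succ]
      simp [alphaAt, boxWeight]

theorem colSum_noAlpha_notBetaAt {n : ℕ} (R : Fin n → Prop) (x y : ℝ) (ρ : Fin n) (hR : R ρ) :
    (1 + y) * colSum R (noAlpha (notBetaAt x y ρ)) = y * rowFactor R y := by
  rw [colSum_noAlpha, rowFactor, ← Finset.mul_prod_erase _ _ (Finset.mem_univ ρ),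
    ← Finset.mul_prod_erase univ (fun i => if R i then 1 + y else 1) (Finset.mem_univ ρ)]
  have h : ∀ i ∈ univ.erase ρ, notBetaAt x y (ρ : ℕ) i.castSucc none +
      (if R i then notBetaAt x y (ρ : ℕ) i.castSucc (some .beta) else 0) =
      if R i then 1 + y else 1 := by
    intro i hi
    have : (i : ℕ) ≠ ρ := fun h => (Finset.mem_erase.1 hi).1 (Fin.ext h)
    split_ifs <;> simp [notBetaAt, boxWeight, this]
  rw [Finset.prod_congr rfl h]
  have hl : n ≠ (ρ : ℕ) := by omega
  simp [notBetaAt, boxWeight, hR, hl]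
  ring

/-- A box other than β is empty or α. Keeping box `ρ` empty amounts to forbidding its row, which
divides the full column sum by `1 + y`. -/
theorem colSum_notBetaAt {n : ℕ} (R : Fin n → Prop) (x y : ℝ) (ρ : Fin n) (hR : R ρ) :
    (1 + y) * colSum R (notBetaAt x y ρ) =
      (x + y) * rowFactor R y + (1 + y) * colSum R (alphaAt x y ρ) := by
  induction n with
  | zero => exact ρ.elim0
  | succ n ih =>
    revert hR
    refine Fin.cases (fun hR => ?_) (fun ρ hR => ?_) ρ
    · rw [colSum_succ, Fin.val_zero, notBetaAt_zero_succ, colSum_boxWeight,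
        colSum_noAlpha_boxWeight, rowFactor_succ, colSum_succ, alphaAt_zero_succ, colSum_boxWeight,
        colSum_noAlpha_boxWeight]
      simp [alphaAt, notBetaAt, boxWeight, hR]
      ring
    · have h1 := ih (fun i => R i.succ) ρ hR
      have h2 := colSum_noAlpha_notBetaAt (fun i => R i.succ) x y ρ hR
      rw [colSum_succ, Fin.val_succ, notBetaAt_succ, colSum_succ R (alphaAt x y (ρ + 1)),
        alphaAt_succ, rowFactor_succ, colSum_noAlpha_alphaAt _ _ _ (by omega)]
      simp only [notBetaAt, alphaAt, boxWeight, Fin.val_zero, (Nat.succ_ne_zero _).symm, if_false,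
        mul_one, mul_zero, ite_self, add_zero, one_mul]
      split_ifs
      · linear_combination h1 + (x + y) * h2
      · linear_combination h1

end

end StaircaseTableau

/-! ### Removing the first column of a tableau -/

namespace StaircaseTableau

noncomputable section

open Finset Classical

variable {n : ℕ}

/-- Row `ρ` contains no `β`. -/
def RowFree (S : StaircaseTableau n) (ρ : ℕ) : Prop :=
  ∀ i j : Fin n, (i : ℕ) = ρ → S.entry i j ≠ some .beta

/-- The first column has an `α` in row `ρ`. -/
def HasAlpha (S : StaircaseTableau n) (ρ : ℕ) : Prop :=
  ∃ i j : Fin n, (i : ℕ) = ρ ∧ (j : ℕ) = 0 ∧ S.entry i j = some .alpha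

/-- The tableau without its first column. -/
def tail (S : StaircaseTableau (n + 1)) : StaircaseTableau n where
  entry i j := S.entry i.castSucc j.succ
  outside i j h := S.outside _ _ (by simp; omega)
  first_diagonal i j h := S.first_diagonal _ _ (by simp; omega)
  north_of_alpha i i' j h hi := S.north_of_alpha _ _ _ h (by simpa using hi)
  west_of_beta i j j' h hj := S.west_of_beta _ _ _ h (by simpa using hj)

/-- A β in the tail empties its row to the west, so a filled box of the first column needs a β-free
row behind it. -/
theorem isColumn_entry (S : StaircaseTableau (n + 1)) :
    IsColumn (fun i : Fin n => S.tail.RowFree i) fun i => S.entry i 0 := by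
  refine ⟨S.first_diagonal _ _ (by simp), fun i i' h hi => S.north_of_alpha _ _ _ h hi,
    fun i hi i' j hii h => hi ?_⟩
  obtain rfl : i' = i := Fin.ext hii
  exact S.west_of_beta _ _ _ h (Fin.succ_pos j)

/-- The tableau with first column `c` and the tableau `S` behind it. -/
def cons (S : StaircaseTableau n) (c : Fin (n + 1) → Option StairSymbol)
    (hc : IsColumn (fun i : Fin n => S.RowFree i) c) : StaircaseTableau (n + 1) where
  -- The new bottom row has a box in the first column only, hence the default `none`.
  entry i j := Fin.cases (c i) (fun j => Fin.lastCases none (fun i => S.entry i j) i) j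
  outside i j := by
    refine Fin.cases ?_ (fun j => ?_) j
    · simp; omega
    · refine Fin.lastCases (by simp) (fun i h => ?_) i
      simpa using S.outside i j (by simp at h; omega)
  first_diagonal i j := by
    refine Fin.cases ?_ (fun j => ?_) j
    · intro h
      obtain rfl : i = Fin.last n := Fin.ext (by simpa using h)
      simpa using hc.1
    · refine Fin.lastCases (fun h => by simp at h) (fun i h => ?_) i
      simpa using S.first_diagonal i j (by simp at h; omega)
  north_of_alpha i i' j := by
    refine Fin.cases ?_ (fun j => ?_) j
    · simpa using hc.2.1 i i'
    · refine Fin.lastCases (by simp) (fun i => ?_) i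
      refine Fin.lastCases (fun _ h => ?_) (fun i' => ?_) i'
      · exact absurd h (by simpa using (Fin.castSucc_lt_last i).le)
      · simpa using S.north_of_alpha i i' j
  west_of_beta i j j' := by
    refine Fin.cases (fun _ h => absurd h (Fin.not_lt_zero j')) (fun j => ?_) j
    refine Fin.lastCases (by simp) (fun i => ?_) i
    refine Fin.cases (fun h _ => ?_) (fun j' => ?_) j'
    · by_contra h'
      exact hc.2.2 i (by simpa using h') i j rfl (by simpa using h)
    · simpa using S.west_of_beta i j j'

theorem tail_cons (S : StaircaseTableau n) (c : Fin (n + 1) → Option StairSymbol)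
    (hc : IsColumn (fun i : Fin n => S.RowFree i) c) : (S.cons c hc).tail = S := by
  ext i j : 3; simp [tail, cons]

/-- A tableau of size `n + 1` is its first column together with the remaining tableau. -/
def consEquiv (n : ℕ) : (Σ S : StaircaseTableau n,
    {c : Fin (n + 1) → Option StairSymbol // IsColumn (fun i : Fin n => S.RowFree i) c}) ≃
      StaircaseTableau (n + 1) where
  toFun p := p.1.cons p.2.1 p.2.2
  invFun S := ⟨S.tail, fun i => S.entry i 0, S.isColumn_entry⟩
  left_inv := by
    rintro ⟨S, c, hc⟩
    have h := tail_cons S c hc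
    refine Sigma.ext h ?_
    rw [Subtype.heq_iff_coe_eq (fun _ => by simp only [h])]
    ext i : 1; simp [cons]
  right_inv S := by
    ext i j : 3
    refine Fin.cases (by simp [cons]) (fun j => ?_) j
    refine Fin.lastCases ?_ (fun i => by simp [cons, tail]) i
    simpa [cons] using (S.outside (Fin.last n) j.succ (by simp)).symm

/-- The product of the weights of all boxes, for weights `x` of `α` and `y` of `β`. -/
def boxProd (x y : ℝ) (S : StaircaseTableau n) : ℝ := ∏ j, ∏ i, boxWeight x y (S.entry i j)

theorem boxProd_eq_tail (x y : ℝ) (S : StaircaseTableau (n + 1)) :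
    S.boxProd x y = S.tail.boxProd x y * ∏ i, boxWeight x y (S.entry i 0) := by
  rw [boxProd, Fin.prod_univ_succ, mul_comm, boxProd]
  congr 1
  refine Finset.prod_congr rfl fun j _ => ?_
  rw [Fin.prod_univ_castSucc, S.outside (Fin.last n) j.succ (by simp)]
  simp [boxWeight, tail]

/-- The first column is summed out with the tail fixed. The factor `t` encodes conditions on the
column as a product over its boxes. -/
theorem sum_boxProd_succ {E : Type*} [AddCommGroup E] [Module ℝ E] (x y : ℝ)
    (t : Fin (n + 1) → Option StairSymbol → ℝ) (F : StaircaseTableau n → E) :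
    ∑ S : StaircaseTableau (n + 1), (S.boxProd x y * ∏ i, t i (S.entry i 0)) • F S.tail =
      ∑ S : StaircaseTableau n, (S.boxProd x y *
        colSum (fun i : Fin n => S.RowFree i) fun i e => boxWeight x y e * t i e) • F S := by
  rw [← (consEquiv n).sum_comp, Fintype.sum_sigma]
  refine Finset.sum_congr rfl fun S _ => ?_
  rw [colSum, ← Finset.sum_filter, Finset.mul_sum, Finset.sum_smul,
    Finset.sum_subtype (univ.filter _) (p := IsColumn fun i : Fin n => S.RowFree i) (by simp)]
  refine Finset.sum_congr rfl fun c _ => ?_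
  simp only [consEquiv, Equiv.coe_fn_mk, boxProd_eq_tail, tail_cons, Finset.prod_mul_distrib]
  simp [cons, mul_assoc]

/-- A row has at most one β. If it has one, `y = (1 + y) * (y / (1 + y))`; if it has none, the
factor `1 + y` is present on both sides. -/
theorem prod_row_boxWeight (S : StaircaseTableau n) (i : Fin n) (x y : ℝ) (hy : 0 < y) :
    (∏ j, boxWeight x y (S.entry i j)) * (if S.RowFree i then 1 + y else 1) =
      (1 + y) * ∏ j, boxWeight x (y / (1 + y)) (S.entry i j) := by
  split_ifs with h
  · rw [mul_comm]
    congr 1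
    refine Finset.prod_congr rfl fun j _ => ?_
    have := h i j rfl
    rcases hS : S.entry i j with _ | _ | _ <;> simp_all [boxWeight]
  · simp only [RowFree] at h
    push Not at h
    obtain ⟨i', j, hi, hj⟩ := h
    obtain rfl : i' = i := Fin.ext hi
    rw [← Finset.mul_prod_erase _ _ (Finset.mem_univ j), ← Finset.mul_prod_erase univ
      (fun j => boxWeight x (y / (1 + y)) (S.entry i' j)) (Finset.mem_univ j), hj]
    have hp : ∏ j ∈ univ.erase j, boxWeight x y (S.entry i' j) =
        ∏ j ∈ univ.erase j, boxWeight x (y / (1 + y)) (S.entry i' j) := by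
      refine Finset.prod_congr rfl fun j' hj' => ?_
      have hne : S.entry i' j' ≠ some .beta := by
        intro h'
        rcases lt_or_gt_of_ne (Finset.mem_erase.1 hj').1 with hlt | hlt
        · rw [S.west_of_beta _ _ _ hj hlt] at h'; cases h'
        · rw [S.west_of_beta _ _ _ h' hlt] at hj; cases hj
      rcases hS : S.entry i' j' with _ | _ | _ <;> simp_all [boxWeight]
    rw [hp]
    simp only [boxWeight]
    field_simp

theorem boxProd_mul_rowFactor (S : StaircaseTableau n) (x y : ℝ) (hy : 0 < y) :
    S.boxProd x y * rowFactor (fun i : Fin n => S.RowFree i) y =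
      (1 + y) ^ n * S.boxProd x (y / (1 + y)) := by
  rw [boxProd, boxProd, rowFactor, Finset.prod_comm, ← Finset.prod_mul_distrib,
    Finset.prod_congr rfl fun i _ => prod_row_boxWeight S i x y hy, Finset.prod_mul_distrib,
    Finset.prod_comm (f := fun j i => boxWeight x (y / (1 + y)) (S.entry i j))]
  simp

theorem boxProd_nonneg {x y : ℝ} (hx : 0 ≤ x) (hy : 0 ≤ y) (S : StaircaseTableau n) :
    0 ≤ S.boxProd x y := by
  refine Finset.prod_nonneg fun j _ => Finset.prod_nonneg fun i _ => ?_
  rcases S.entry i j with _ | _ | _ <;> simp [boxWeight, hx, hy]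

theorem boxProd_pos {x y : ℝ} (hx : 0 < x) (hy : 0 < y) (S : StaircaseTableau n) :
    0 < S.boxProd x y := by
  refine Finset.prod_pos fun j _ => Finset.prod_pos fun i _ => ?_
  rcases S.entry i j with _ | _ | _ <;> simp [boxWeight, hx, hy]

/-! ### Reciprocal parameters, partition function and expectations -/

/-- The partition function for the reciprocal parameters `a` and `b`. -/
def boxSum (n : ℕ) (a b : ℝ) : ℝ := ∑ S : StaircaseTableau n, S.boxProd a⁻¹ b⁻¹

theorem boxSum_pos {a b : ℝ} (ha : 0 < a) (hb : 0 < b) : 0 < boxSum n a b :=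
  Finset.sum_pos (fun S _ => boxProd_pos (inv_pos.2 ha) (inv_pos.2 hb) S)
    ⟨diagonalTableau n .alpha, Finset.mem_univ _⟩

/-- The reason for working with reciprocals: the change of weight caused by a column becomes a shift
by one. -/
theorem inv_div_one_add_inv {b : ℝ} (hb : 0 < b) : b⁻¹ / (1 + b⁻¹) = (b + 1)⁻¹ := by
  field_simp

theorem sum_boxProd_tail {E : Type*} [AddCommGroup E] [Module ℝ E] {a b : ℝ} (hb : 0 < b)
    (F : StaircaseTableau n → E) :
    ∑ S : StaircaseTableau (n + 1), S.boxProd a⁻¹ b⁻¹ • F S.tail =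
      ((a⁻¹ + b⁻¹) * (1 + b⁻¹) ^ n) •
        ∑ S : StaircaseTableau n, S.boxProd a⁻¹ (b + 1)⁻¹ • F S := by
  have h := sum_boxProd_succ a⁻¹ b⁻¹ (fun _ _ => 1) F
  simp only [Finset.prod_const_one, mul_one] at h
  rw [h, Finset.smul_sum]
  refine Finset.sum_congr rfl fun S _ => ?_
  rw [colSum_boxWeight, smul_smul, mul_left_comm, boxProd_mul_rowFactor _ _ _ (inv_pos.2 hb),
    inv_div_one_add_inv hb, mul_assoc]

theorem boxSum_succ {a b : ℝ} (hb : 0 < b) :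
    boxSum (n + 1) a b = (a⁻¹ + b⁻¹) * (1 + b⁻¹) ^ n * boxSum n a (b + 1) := by
  simpa [boxSum] using sum_boxProd_tail (n := n) (a := a) hb fun _ => (1 : ℝ)

/-- Unlike `boxSum_succ`, this compares two sizes at the same parameters. The induction works
because `a + (b + 1) + n = a + b + (n + 1)`. -/
theorem boxSum_succ' {a b : ℝ} (ha : 0 < a) (hb : 0 < b) :
    boxSum (n + 1) a b = (a + b + n) * (a⁻¹ * b⁻¹) * boxSum n a b := by
  induction n generalizing b with
  | zero =>
    have : boxSum 0 a (b + 1) = boxSum 0 a b := by simp [boxSum, boxProd]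
    rw [boxSum_succ hb, this]
    field_simp
    simp; ring
  | succ n ih =>
    rw [boxSum_succ hb, ih (b := b + 1) (by positivity), boxSum_succ hb, pow_succ]
    generalize (1 + b⁻¹) ^ n = p
    push_cast
    field_simp
    ring

/-- The expectation of `F` for the reciprocal parameters `a` and `b`. -/
def mean {E : Type*} [AddCommGroup E] [Module ℝ E] (a b : ℝ) (F : StaircaseTableau n → E) : E :=
  (boxSum n a b)⁻¹ • ∑ S : StaircaseTableau n, S.boxProd a⁻¹ b⁻¹ • F S

section mean

variable {E : Type*} [NormedAddCommGroup E] [NormedSpace ℝ E] {a b : ℝ}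

theorem mean_add (F G : StaircaseTableau n → E) :
    mean a b (fun S => F S + G S) = mean a b F + mean a b G := by
  simp [mean, smul_add, Finset.sum_add_distrib]

theorem mean_sub (F G : StaircaseTableau n → E) :
    mean a b (fun S => F S - G S) = mean a b F - mean a b G := by
  simp [mean, smul_sub, Finset.sum_sub_distrib]

theorem mean_const_smul (c : ℝ) (F : StaircaseTableau n → E) :
    mean a b (fun S => c • F S) = c • mean a b F := by
  simp [mean, smul_comm c, Finset.smul_sum]

theorem mean_const_mul (c : ℂ) (F : StaircaseTableau n → ℂ) :
    mean a b (fun S => c * F S) = c * mean a b F := by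
  simp [mean, Finset.mul_sum, mul_left_comm]

theorem mean_const (ha : 0 < a) (hb : 0 < b) (c : E) :
    mean a b (fun _ : StaircaseTableau n => c) = c := by
  rw [mean, ← Finset.sum_smul, ← boxSum, inv_smul_smul₀ (boxSum_pos ha hb).ne']

theorem mean_mono (ha : 0 < a) (hb : 0 < b) {F G : StaircaseTableau n → ℝ} (h : ∀ S, F S ≤ G S) :
    mean a b F ≤ mean a b G := by
  refine mul_le_mul_of_nonneg_left (Finset.sum_le_sum fun S _ => ?_)
    (inv_nonneg.2 (boxSum_pos ha hb).le)
  exact mul_le_mul_of_nonneg_left (h S)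
    (boxProd_nonneg (inv_nonneg.2 ha.le) (inv_nonneg.2 hb.le) S)

theorem norm_mean_le (ha : 0 < a) (hb : 0 < b) {F : StaircaseTableau n → E}
    {G : StaircaseTableau n → ℝ} (h : ∀ S, ‖F S‖ ≤ G S) :
    ‖mean a b F‖ ≤ mean a b G := by
  refine le_trans ?_ (mean_mono ha hb h)
  rw [mean, mean, norm_smul, Real.norm_of_nonneg (inv_nonneg.2 (boxSum_pos ha hb).le), smul_eq_mul]
  refine mul_le_mul_of_nonneg_left ((norm_sum_le _ _).trans (Finset.sum_le_sum fun S _ => ?_))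
    (inv_nonneg.2 (boxSum_pos ha hb).le)
  rw [norm_smul, Real.norm_of_nonneg (boxProd_nonneg (inv_nonneg.2 ha.le) (inv_nonneg.2 hb.le) S),
    smul_eq_mul]

theorem mean_tail (ha : 0 < a) (hb : 0 < b) (F : StaircaseTableau n → E) :
    mean a b (fun S : StaircaseTableau (n + 1) => F S.tail) = mean a (b + 1) F := by
  rw [mean, sum_boxProd_tail hb, boxSum_succ hb, mean, smul_smul]
  congr 1
  have h1 : (a⁻¹ + b⁻¹) * (1 + b⁻¹) ^ n ≠ 0 := by positivity
  have h2 := (boxSum_pos (n := n) ha (b := b + 1) (by positivity)).ne'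
  field_simp

theorem prod_ite_row {m ρ : ℕ} (hρ : ρ < m) (e : Fin m → Option StairSymbol)
    (P : Option StairSymbol → Prop) [DecidablePred P] :
    (∏ i : Fin m, if (i : ℕ) = ρ then (if P (e i) then (1 : ℝ) else 0) else 1) =
      if P (e ⟨ρ, hρ⟩) then 1 else 0 := by
  rw [Finset.prod_eq_single ⟨ρ, hρ⟩] <;> simp +contextual [Fin.ext_iff]

theorem hasAlpha_iff {ρ : ℕ} (hρ : ρ < n + 1) (S : StaircaseTableau (n + 1)) :
    S.HasAlpha ρ ↔ S.entry ⟨ρ, hρ⟩ 0 = some .alpha := by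
  constructor
  · rintro ⟨i, j, rfl, hj, h⟩
    obtain rfl : j = 0 := Fin.ext hj
    exact h
  · intro h
    exact ⟨_, 0, rfl, rfl, h⟩

theorem sum_boxProd_hasAlpha {ρ : ℕ} (hρ : ρ < n + 1) (x y : ℝ) (F : StaircaseTableau n → E) :
    ∑ S : StaircaseTableau (n + 1), S.boxProd x y • (if S.HasAlpha ρ then F S.tail else 0) =
      ∑ S : StaircaseTableau n,
        (S.boxProd x y * colSum (fun i : Fin n => S.RowFree i) (alphaAt x y ρ)) • F S := by
  have h := sum_boxProd_succ x y (fun (i : Fin (n + 1)) e =>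
    if (i : ℕ) = ρ then (if e = some .alpha then (1 : ℝ) else 0) else 1) F
  simp only [prod_ite_row hρ _ (fun e => e = some .alpha)] at h
  refine Eq.trans ?_ h
  refine Finset.sum_congr rfl fun S _ => ?_
  rw [hasAlpha_iff hρ]
  split_ifs <;> simp

/-- An α in the bottom box leaves the rest of the column empty, so the column has constant weight
and `b` is not shifted. -/
theorem mean_hasAlpha_last (ha : 0 < a) (hb : 0 < b) (F : StaircaseTableau n → E) :
    mean a b (fun S : StaircaseTableau (n + 1) => if S.HasAlpha n then F S.tail else 0) =
      (b / (a + b + n)) • mean a b F := by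
  rw [mean, sum_boxProd_hasAlpha (Nat.lt_succ_self n), boxSum_succ' ha hb, mean, smul_smul]
  simp only [colSum_alphaAt_last, mul_comm _ a⁻¹, ← smul_smul a⁻¹, ← Finset.smul_sum]
  rw [smul_smul]
  congr 1
  have h2 := (boxSum_pos (n := n) ha hb).ne'
  field_simp

/-- The factor contributed by the rows without `β` below row `ρ`. -/
def lowerFactor (S : StaircaseTableau n) (ρ : Fin n) (y : ℝ) : ℝ :=
  rowFactor (fun i => ρ < i ∧ S.RowFree i) y

/-- The boxes above the α are empty, so only the rows below `ρ` retain a factor `1 + b⁻¹`, and `b`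
is again not shifted. The scalar comes from `boxSum_succ'`. -/
theorem mean_hasAlpha (ha : 0 < a) (hb : 0 < b) (ρ : Fin n) (F : StaircaseTableau n → E) :
    mean a b (fun S : StaircaseTableau (n + 1) => if S.HasAlpha ρ then F S.tail else 0) =
      (1 / (a + b + n)) • mean a b (fun S : StaircaseTableau n =>
        if S.RowFree ρ then S.lowerFactor ρ b⁻¹ • F S else 0) := by
  rw [mean, sum_boxProd_hasAlpha (by omega), boxSum_succ' ha hb, mean, smul_smul]
  have h : ∀ S : StaircaseTableau n, (S.boxProd a⁻¹ b⁻¹ *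
      colSum (fun i : Fin n => S.RowFree i) (alphaAt a⁻¹ b⁻¹ ρ)) • F S =
      (a⁻¹ * b⁻¹) • S.boxProd a⁻¹ b⁻¹ •
        (if S.RowFree ρ then S.lowerFactor ρ b⁻¹ • F S else 0) := by
    intro S
    rw [colSum_alphaAt]
    split_ifs
    · simp only [smul_smul, lowerFactor]
      congr 1; ring
    · simp
  simp only [h, ← Finset.smul_sum]
  rw [smul_smul]
  congr 1
  have h2 := (boxSum_pos (n := n) ha hb).ne'
  field_simp

theorem rowFree_iff (S : StaircaseTableau (n + 1)) (ρ : Fin n) :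
    S.RowFree ρ ↔ S.tail.RowFree ρ ∧ S.entry ρ.castSucc 0 ≠ some .beta := by
  constructor
  · intro h
    exact ⟨fun i j hi => h _ _ (by simpa using hi), h _ _ (by simp)⟩
  · rintro ⟨h1, h2⟩ i j hi
    obtain rfl : i = ρ.castSucc := Fin.ext (by simpa using hi)
    exact Fin.cases h2 (fun j => h1 ρ j rfl) j

/-- A β-free row of the tail stays β-free if its new box is empty, with conditional probability `1 /
(1 + b⁻¹) = b / (b + 1)`, or is an α. -/
theorem mean_rowFree (ha : 0 < a) (hb : 0 < b) (ρ : Fin n) (F : StaircaseTableau n → E) :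
    mean a b (fun S : StaircaseTableau (n + 1) => if S.RowFree ρ then F S.tail else 0) =
      (b / (b + 1)) • mean a (b + 1) (fun S : StaircaseTableau n =>
        if S.RowFree ρ then F S else 0) +
      mean a b (fun S : StaircaseTableau (n + 1) => if S.HasAlpha ρ then F S.tail else 0) := by
  rw [← mean_tail ha hb, mean, mean, mean, ← smul_comm, ← smul_add]
  congr 1
  have h := sum_boxProd_succ a⁻¹ b⁻¹ (fun (i : Fin (n + 1)) e =>
    if (i : ℕ) = ρ then (if e ≠ some .beta then (1 : ℝ) else 0) else 1)
    (fun S => if S.RowFree ρ then F S else 0)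
  simp only [prod_ite_row (m := n + 1) (ρ := ρ) (by omega) _ (fun e => e ≠ some .beta)] at h
  have h1 := sum_boxProd_succ a⁻¹ b⁻¹ (fun _ _ => 1) (fun S => if S.RowFree ρ then F S else 0)
  simp only [Finset.prod_const_one, mul_one] at h1
  rw [sum_boxProd_hasAlpha (by omega), h1, Finset.smul_sum, ← Finset.sum_add_distrib]
  refine Eq.trans ?_ (h.trans ?_)
  · refine Finset.sum_congr rfl fun S _ => ?_
    rw [rowFree_iff]
    have : (⟨(ρ : ℕ), by omega⟩ : Fin (n + 1)) = ρ.castSucc := rfl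
    rw [this]
    by_cases h1 : S.tail.RowFree ρ <;> by_cases h2 : S.entry ρ.castSucc 0 = some .beta <;>
      simp [h1, h2]
  · refine Finset.sum_congr rfl fun S _ => ?_
    by_cases hS : S.RowFree ρ
    · simp only [hS, if_true, smul_smul, ← add_smul]
      congr 1
      have hn := colSum_notBetaAt (fun i : Fin n => S.RowFree i) a⁻¹ b⁻¹ ρ hS
      have he : (fun (i : Fin (n + 1)) e => boxWeight a⁻¹ b⁻¹ e *
          if (i : ℕ) = ρ then (if e ≠ some .beta then (1 : ℝ) else 0) else 1) =
          notBetaAt a⁻¹ b⁻¹ ρ := by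
        ext i e; simp only [notBetaAt, ite_not]
      rw [he, colSum_boxWeight]
      have hb1 : b / (b + 1) * (1 + b⁻¹) = 1 := by field_simp
      linear_combination (S.boxProd a⁻¹ b⁻¹) * (b / (b + 1)) * hn +
        S.boxProd a⁻¹ b⁻¹ * (colSum (fun i : Fin n => S.RowFree i) (alphaAt a⁻¹ b⁻¹ ρ) -
        colSum (fun i : Fin n => S.RowFree i) (notBetaAt a⁻¹ b⁻¹ ρ)) * hb1
    · simp [hS, colSum_alphaAt]

theorem one_le_lowerFactor (S : StaircaseTableau n) (ρ : Fin n) {y : ℝ} (hy : 0 ≤ y) :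
    1 ≤ S.lowerFactor ρ y := by
  have h : (1 : ℝ) = ∏ _i : Fin n, 1 := by simp
  rw [h]
  refine Finset.prod_le_prod (fun _ _ => zero_le_one) fun i _ => ?_
  split_ifs <;> linarith

theorem lowerFactor_le (S : StaircaseTableau n) (ρ : Fin n) {y : ℝ} (hy : 0 ≤ y) :
    S.lowerFactor ρ y ≤ (1 + y) ^ (n - 1 - ρ) := by
  calc S.lowerFactor ρ y ≤ ∏ i, (if ρ < i then 1 + y else 1) := by
        unfold lowerFactor rowFactor
        refine Finset.prod_le_prod (fun i _ => ?_) fun i _ => ?_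
        · split_ifs <;> linarith
        · split_ifs <;> simp_all
    _ = (1 + y) ^ (n - 1 - ρ) := by
        rw [Finset.prod_ite]
        simp [← Fin.card_Ioi, Finset.filter_lt_eq_Ioi]

/-- An α in row `ρ` requires that row of the tail to be β-free. This crude bound serves for `b < 1`,
where `lowerFactor` has no bound independent of `b`. -/
theorem mean_hasAlpha_le (ha : 0 < a) (hb : 0 < b) (ρ : Fin n) :
    mean a b (fun S : StaircaseTableau (n + 1) => if S.HasAlpha ρ then (1 : ℝ) else 0) ≤
      mean a (b + 1) (fun S : StaircaseTableau n => if S.RowFree ρ then (1 : ℝ) else 0) := by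
  rw [← mean_tail ha hb, mean, mean]
  refine mul_le_mul_of_nonneg_left ?_ (inv_nonneg.2 (boxSum_pos ha hb).le)
  have h1 := sum_boxProd_succ a⁻¹ b⁻¹ (fun _ _ => 1)
    (fun S : StaircaseTableau n => if S.RowFree ρ then (1 : ℝ) else 0)
  simp only [Finset.prod_const_one, mul_one] at h1
  rw [h1, sum_boxProd_hasAlpha (by omega) _ _ fun _ => (1 : ℝ)]
  refine Finset.sum_le_sum fun S _ => ?_
  rw [colSum_boxWeight, colSum_alphaAt]
  by_cases hS : S.RowFree ρ
  · simp only [hS, if_true, smul_eq_mul, mul_one]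
    have hx : 0 < a⁻¹ := inv_pos.2 ha
    have hy : 0 < b⁻¹ := inv_pos.2 hb
    refine mul_le_mul_of_nonneg_left ?_ (boxProd_nonneg hx.le hy.le S)
    have hR : (1 + b⁻¹) * rowFactor (fun i => ρ < i ∧ S.RowFree i) b⁻¹ ≤
        rowFactor (fun i : Fin n => S.RowFree i) b⁻¹ := by
      rw [rowFactor, rowFactor, ← Finset.mul_prod_erase _ _ (Finset.mem_univ ρ),
        ← Finset.mul_prod_erase univ (fun i : Fin n => if S.RowFree i then 1 + b⁻¹ else 1)
          (Finset.mem_univ ρ)]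
      simp only [lt_self_iff_false, false_and, if_false, one_mul, hS, if_true]
      refine mul_le_mul_of_nonneg_left (Finset.prod_le_prod (fun i _ => ?_) fun i _ => ?_)
        (by positivity)
      · split_ifs <;> positivity
      · split_ifs <;> simp_all [hb.le]
    have hL := one_le_lowerFactor S ρ hy.le
    rw [lowerFactor] at hL
    calc a⁻¹ * b⁻¹ * rowFactor (fun i => ρ < i ∧ S.RowFree i) b⁻¹ ≤
        (a⁻¹ + b⁻¹) * ((1 + b⁻¹) * rowFactor (fun i => ρ < i ∧ S.RowFree i) b⁻¹) := by
          rw [← mul_assoc]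
          refine mul_le_mul_of_nonneg_right ?_ (by linarith)
          nlinarith [mul_pos hx hy]
      _ ≤ _ := mul_le_mul_of_nonneg_left hR (by positivity)
  · simp [hS]

end mean

/-- The contribution of the first column to the number of `α`'s on the `k`-th diagonal. -/
theorem diagCount_succ (S : StaircaseTableau (n + 1)) (k : ℕ) :
    S.diagCount k .alpha = S.tail.diagCount k .alpha +
      if k ≤ n + 1 ∧ S.HasAlpha (n + 1 - k) then 1 else 0 := by
  have hsum : ∀ {m : ℕ} (T : StaircaseTableau m), T.diagCount k .alpha =
      ∑ j : Fin m, ∑ i : Fin m,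
        if (i : ℕ) + (j : ℕ) + k = m ∧ T.entry i j = some .alpha then 1 else 0 := by
    intro m T
    rw [diagCount, Set.ncard_eq_toFinset_card', Finset.card_eq_sum_ones, Finset.sum_comm,
      ← Fintype.sum_prod_type' (f := fun i j : Fin m => if (i : ℕ) + (j : ℕ) + k = m ∧
        T.entry i j = some .alpha then 1 else 0), ← Finset.sum_filter]
    refine Finset.sum_congr ?_ fun _ _ => rfl
    ext p; simp
  rw [hsum, hsum, Fin.sum_univ_succ, add_comm]
  congr 1
  · refine Finset.sum_congr rfl fun j _ => ?_
    rw [Fin.sum_univ_castSucc, S.outside (Fin.last n) j.succ (by simp)]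
    simp only [reduceCtorEq, and_false, if_false, add_zero]
    refine Finset.sum_congr rfl fun i _ => ?_
    simp only [tail, Fin.val_castSucc, Fin.val_succ]
    congr 1
    rw [show (i : ℕ) + (j + 1) + k = n + 1 ↔ (i : ℕ) + j + k = n by omega]
  -- The diagonal misses the first column when `k > n + 1` or `k = 0`; with truncated subtraction
  -- these are two separate conditions.
  · by_cases h : k ≤ n + 1 ∧ n + 1 - k < n + 1
    · rw [hasAlpha_iff h.2, Finset.sum_eq_single ⟨n + 1 - k, h.2⟩]
      · simp [h.1]
      · intro i _ hi
        rw [if_neg]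
        rintro ⟨h1, -⟩
        exact hi (Fin.ext (by simp at h1 ⊢; omega))
      · simp
    · have h0 : ∀ i : Fin (n + 1), ¬ ((i : ℕ) + (0 : Fin (n + 1)) + k = n + 1 ∧
          S.entry i 0 = some .alpha) := by
        rintro i ⟨h1, -⟩
        simp at h1
        omega
      rw [Finset.sum_congr rfl fun i _ => if_neg (h0 i), if_neg]
      · simp
      · rintro ⟨h1, i, -, hi, -⟩
        exact h ⟨h1, by omega⟩

end

end StaircaseTableau

/-! ### Generating functions and their approximate recursion -/

namespace StaircaseTableau

noncomputable section

open Finset Classical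

variable {n : ℕ} {a b : ℝ} {z : ℂ}

theorem mean_ofReal (F : StaircaseTableau n → ℝ) :
    mean a b (fun S => (F S : ℂ)) = (mean a b F : ℝ) := by
  simp [mean]

/-- The probability generating function of the number of `α`'s on the `k`-th diagonal. -/
def diagGen (k n : ℕ) (a b : ℝ) (z : ℂ) : ℂ :=
  mean a b fun S : StaircaseTableau n => z ^ S.diagCount k .alpha

theorem norm_diagGen_le (ha : 0 < a) (hb : 0 < b) (hz : ‖z‖ ≤ 1) (k n : ℕ) :
    ‖diagGen k n a b z‖ ≤ 1 := by
  refine (norm_mean_le ha hb fun S => ?_).trans_eq (mean_const ha hb (1 : ℝ))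
  rw [norm_pow]
  exact pow_le_one₀ (norm_nonneg _) hz

theorem diagCount_eq_zero {k : ℕ} (h : n < k) (S : StaircaseTableau n) (x : StairSymbol) :
    S.diagCount k x = 0 := by
  rw [diagCount, Set.ncard_eq_zero]
  ext p
  simp; omega

theorem diagGen_eq_one (ha : 0 < a) (hb : 0 < b) {k : ℕ} (h : n < k) : diagGen k n a b z = 1 := by
  simp only [diagGen, diagCount_eq_zero h, pow_zero]
  exact mean_const ha hb 1

theorem not_hasAlpha_of_lt (S : StaircaseTableau n) {ρ σ : ℕ} (h : S.HasAlpha ρ) (hσ : σ < ρ) :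
    ¬ S.HasAlpha σ := by
  obtain ⟨i, j, rfl, hj, he⟩ := h
  rintro ⟨i', j', rfl, hj', he'⟩
  obtain rfl : j = j' := Fin.ext (hj.trans hj'.symm)
  rw [S.north_of_alpha _ _ _ he hσ] at he'
  cases he'

theorem rowFree_last (S : StaircaseTableau (n + 1)) : S.RowFree n ↔ S.HasAlpha n := by
  rw [hasAlpha_iff (Nat.lt_succ_self n)]
  have hl : (⟨n, Nat.lt_succ_self n⟩ : Fin (n + 1)) = Fin.last n := rfl
  rw [hl]
  constructor
  · intro h
    have h1 := h (Fin.last n) 0 rfl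
    have h2 := S.first_diagonal (Fin.last n) 0 (by simp)
    rcases hS : S.entry (Fin.last n) 0 with _ | _ | _ <;> simp_all
  · intro h i j hi
    obtain rfl : i = Fin.last n := Fin.ext hi
    refine Fin.cases (by simp [h]) (fun j => ?_) j
    rw [S.outside _ _ (by simp)]
    simp

/-- By convexity, the power lies below its chord on `[0, 1]`. -/
theorem one_add_pow_le {y : ℝ} (hy : 0 ≤ y) (hy1 : y ≤ 1) (m : ℕ) :
    (1 + y) ^ m ≤ 1 + (2 ^ m - 1) * y := by
  induction m with
  | zero => simp
  | succ m ih =>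
    have h2 : (1 : ℝ) ≤ 2 ^ m := one_le_pow₀ (by norm_num)
    rw [pow_succ, pow_succ]
    nlinarith [mul_le_mul_of_nonneg_right ih (by linarith : (0 : ℝ) ≤ 1 + y),
      mul_nonneg (mul_nonneg (sub_nonneg.2 h2) hy) (sub_nonneg.2 hy1)]

theorem mean_hasAlpha_le_of_one_le (ha : 0 < a) (hb : 1 ≤ b) {ρ k : ℕ} (hρ : ρ < n)
    (hk : n - 1 - ρ ≤ k) :
    mean a b (fun S : StaircaseTableau (n + 1) => if S.HasAlpha ρ then (1 : ℝ) else 0) ≤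
      2 ^ k / (a + b + n) := by
  have hb0 : 0 < b := by linarith
  rw [mean_hasAlpha ha hb0 ⟨ρ, hρ⟩ fun _ => (1 : ℝ), smul_eq_mul, one_div, div_eq_inv_mul]
  refine mul_le_mul_of_nonneg_left ?_ (by positivity)
  rw [← mean_const (n := n) ha hb0 ((2 : ℝ) ^ k)]
  refine mean_mono ha hb0 fun S => ?_
  split_ifs
  · rw [smul_eq_mul, mul_one]
    have hy : b⁻¹ ≤ 1 := inv_le_one_of_one_le₀ hb
    calc S.lowerFactor ⟨ρ, hρ⟩ b⁻¹ ≤ (1 + b⁻¹) ^ (n - 1 - ρ) := S.lowerFactor_le _ (by positivity)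
      _ ≤ 2 ^ (n - 1 - ρ) := pow_le_pow_left₀ (by positivity) (by linarith) _
      _ ≤ 2 ^ k := pow_le_pow_right₀ (by norm_num) hk
  · positivity

/-- Here `k ≥ 2` is essential: the diagonal avoids the bottom box of the column, where an α has
probability `b / (a + b + n)`, which is not small for large `b`. -/
theorem mean_diag_hasAlpha_le (ha : 0 < a) (hb : 1 ≤ b) {k : ℕ} (hk : 2 ≤ k) :
    mean a b (fun S : StaircaseTableau (n + 1) =>
      if k ≤ n + 1 ∧ S.HasAlpha (n + 1 - k) then (1 : ℝ) else 0) ≤ 2 ^ k / (a + b + n) := by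
  by_cases h : k ≤ n + 1
  · simp only [h, true_and]
    exact mean_hasAlpha_le_of_one_le ha hb (by omega) (by omega)
  · simp only [h, false_and, if_false]
    rw [mean_const ha (by linarith)]
    positivity

theorem norm_pow_diagCount_sub_le (hz : ‖z‖ ≤ 1) (S : StaircaseTableau (n + 1)) (k : ℕ) :
    ‖z ^ S.diagCount k .alpha - z ^ S.tail.diagCount k .alpha‖ ≤
      2 * if k ≤ n + 1 ∧ S.HasAlpha (n + 1 - k) then (1 : ℝ) else 0 := by
  rw [diagCount_succ]
  split_ifs with h
  · refine (norm_sub_le _ _).trans ?_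
    rw [norm_pow, norm_pow]
    linarith [pow_le_one₀ (n := S.tail.diagCount k .alpha + 1) (norm_nonneg z) hz,
      pow_le_one₀ (n := S.tail.diagCount k .alpha) (norm_nonneg z) hz]
  · simp

/-- The generating function restricted to tableaux without `β` in row `n`. -/
def freeGen (k n m : ℕ) (a b : ℝ) (z : ℂ) : ℂ :=
  mean a b fun S : StaircaseTableau (n + m + 1) =>
    if S.RowFree n then z ^ S.diagCount k .alpha else 0

/-- The bottom row has a single, filled box, so it is β-free exactly when that box is α; the column
then has no other α and adds nothing to the diagonal. -/
theorem freeGen_zero (ha : 0 < a) (hb : 0 < b) {k : ℕ} (hk : 2 ≤ k) :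
    freeGen k n 0 a b z = (b / (a + b + n)) • diagGen k n a b z := by
  rw [diagGen, ← mean_hasAlpha_last ha hb, freeGen]
  congr 1
  ext S
  rw [rowFree_last]
  split_ifs with h
  · rw [diagCount_succ, if_neg]
    · simp
    · rintro ⟨h1, h2⟩
      exact not_hasAlpha_of_lt S h (by omega) h2
  · rfl

/-- The constant 3 is 2 + 1: passing to the diagonal count of the tail costs twice the probability
of an α in the new diagonal box, and dropping the α term of `mean_rowFree` costs one more such
probability. -/
theorem norm_freeGen_succ_sub_le (ha : 0 < a) (hb : 1 ≤ b) (hz : ‖z‖ ≤ 1) {k m : ℕ} (hk : 2 ≤ k)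
    (hm : m ≤ k) :
    ‖freeGen k n (m + 1) a b z - (b / (b + 1)) • freeGen k n m a (b + 1) z‖ ≤
      3 * 2 ^ k / (a + b + n + m + 1) := by
  have hb0 : 0 < b := by linarith
  have h1 := mean_rowFree (n := n + m + 1) ha hb0 ⟨n, by omega⟩
    (fun S => z ^ S.diagCount k .alpha)
  have h2 : freeGen k n (m + 1) a b z - (b / (b + 1)) • freeGen k n m a (b + 1) z =
      mean a b (fun S : StaircaseTableau (n + m + 1 + 1) =>
        (if S.RowFree n then z ^ S.diagCount k .alpha else 0) -
        (if S.RowFree n then z ^ S.tail.diagCount k .alpha else 0)) +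
      mean a b (fun S : StaircaseTableau (n + m + 1 + 1) =>
        if S.HasAlpha n then z ^ S.tail.diagCount k .alpha else 0) := by
    rw [mean_sub, h1]
    exact (fun X Y W => by abel : ∀ X Y W : ℂ, X - Y = X - (Y + W) + W) _ _ _
  rw [h2]
  have h3 := mean_diag_hasAlpha_le (n := n + m + 1) ha hb hk
  have h4 := mean_hasAlpha_le_of_one_le (n := n + m + 1) (ρ := n) (k := k) ha hb (by omega)
    (by omega)
  have h5 : ‖mean a b (fun S : StaircaseTableau (n + m + 1 + 1) =>
        (if S.RowFree n then z ^ S.diagCount k .alpha else 0) -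
        (if S.RowFree n then z ^ S.tail.diagCount k .alpha else 0))‖ ≤
      2 * mean a b (fun S : StaircaseTableau (n + m + 1 + 1) =>
      if k ≤ n + m + 1 + 1 ∧ S.HasAlpha (n + m + 1 + 1 - k) then (1 : ℝ) else 0) := by
    rw [← smul_eq_mul, ← mean_const_smul]
    refine norm_mean_le ha hb0 fun S => ?_
    rw [smul_eq_mul]
    by_cases h : S.RowFree n
    · simpa only [h, if_true] using norm_pow_diagCount_sub_le hz S k
    · simp only [h, if_false, sub_self, norm_zero]
      split_ifs <;> norm_num
  have h6 : ‖mean a b (fun S : StaircaseTableau (n + m + 1 + 1) =>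
        if S.HasAlpha n then z ^ S.tail.diagCount k .alpha else 0)‖ ≤
      mean a b (fun S : StaircaseTableau (n + m + 1 + 1) =>
        if S.HasAlpha n then (1 : ℝ) else 0) := by
    refine norm_mean_le ha hb0 fun S => ?_
    split_ifs
    · rw [norm_pow]; exact pow_le_one₀ (norm_nonneg _) hz
    · simp
  refine (norm_add_le _ _).trans ?_
  have h7 : (3 : ℝ) * 2 ^ k / (a + b + n + m + 1) =
      2 * (2 ^ k / (a + b + (n + m + 1 : ℕ))) + 2 ^ k / (a + b + (n + m + 1 : ℕ)) := by
    push_cast; ring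
  rw [h7]
  linarith

/-- Removing `m` columns makes row `n` the bottom row. The factors `b / (b + 1)`, `(b + 1) / (b +
2)`, … telescope to `b / (b + m)`, and the corner contributes `(b + m) / (a + b + m + n)`. -/
theorem norm_freeGen_sub_le (ha : 0 < a) (hb : 1 ≤ b) (hz : ‖z‖ ≤ 1) {k m : ℕ} (hk : 2 ≤ k)
    (hm : m ≤ k) :
    ‖freeGen k n m a b z - (b / (a + b + n + m)) • diagGen k n a (b + m) z‖ ≤
      3 * m * 2 ^ k / (a + b + n + m) := by
  induction m generalizing b with
  | zero => rw [freeGen_zero ha (by linarith) hk]; simp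
  | succ m ih =>
    have hb0 : 0 < b := by linarith
    have h1 := ih (b := b + 1) (by linarith) (by omega)
    have h2 := norm_freeGen_succ_sub_le (n := n) ha hb hz hk (by omega : m ≤ k)
    have e1 : a + (b + 1) + n + m = a + b + n + m + 1 := by ring
    have e2 : b + 1 + (m : ℝ) = b + (m + 1 : ℕ) := by push_cast; ring
    have e3 : a + b + n + (m + 1 : ℕ) = a + b + n + m + 1 := by push_cast; ring
    rw [e1, e2] at h1
    rw [e3]
    have h3 : freeGen k n (m + 1) a b z - (b / (a + b + n + m + 1)) •
        diagGen k n a (b + (m + 1 : ℕ)) z =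
        (freeGen k n (m + 1) a b z - (b / (b + 1)) • freeGen k n m a (b + 1) z) +
        (b / (b + 1)) • (freeGen k n m a (b + 1) z - ((b + 1) / (a + b + n + m + 1)) •
          diagGen k n a (b + (m + 1 : ℕ)) z) := by
      rw [smul_sub, smul_smul]
      have : b / (b + 1) * ((b + 1) / (a + b + n + m + 1)) = b / (a + b + n + m + 1) := by
        field_simp
      rw [this]; abel
    have h4 : ‖(b / (b + 1)) • (freeGen k n m a (b + 1) z - ((b + 1) / (a + b + n + m + 1)) •
          diagGen k n a (b + (m + 1 : ℕ)) z)‖ ≤ 3 * m * 2 ^ k / (a + b + n + m + 1) := by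
      rw [norm_smul, Real.norm_of_nonneg (by positivity)]
      refine (mul_le_of_le_one_left (norm_nonneg _) ?_).trans h1
      rw [div_le_one (by positivity)]; linarith
    rw [h3]
    refine (norm_add_le _ _).trans ((add_le_add h2 h4).trans_eq ?_)
    push_cast; ring

theorem mean_rowFree_le (ha : 0 < a) (hb : 1 ≤ b) {k m : ℕ} (hk : 2 ≤ k) (hm : m ≤ k) :
    mean a b (fun S : StaircaseTableau (n + m + 1) => if S.RowFree n then (1 : ℝ) else 0) ≤
      (b + 3 * m * 2 ^ k) / (a + b + n + m) := by
  have hb0 : 0 < b := by linarith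
  have h := norm_freeGen_sub_le (n := n) ha hb (z := 1) (by simp) hk hm
  have h1 : freeGen k n m a b 1 = (mean a b (fun S : StaircaseTableau (n + m + 1) =>
      if S.RowFree n then (1 : ℝ) else 0) : ℝ) := by
    rw [← mean_ofReal, freeGen]
    congr 1; ext S; split_ifs <;> simp
  have h2 : diagGen k n a (b + m) 1 = 1 := by
    simp only [diagGen, one_pow]
    exact mean_const ha (by positivity) 1
  rw [h1, h2, Complex.real_smul, mul_one, ← Complex.ofReal_sub, Complex.norm_real] at h
  have h3 := (abs_le.1 h).2
  rw [add_div]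
  linarith

/-- The expectation over the tableaux with an `α` where the first column meets the diagonal
factorizes up to a small error. -/
theorem norm_mean_hasAlpha_sub_le (ha : 0 < a) (hb : 1 ≤ b) (hz : ‖z‖ ≤ 1) (k : ℕ) :
    ‖mean a b (fun S : StaircaseTableau (n + k + 1 + 1) =>
      if S.HasAlpha n then z ^ S.tail.diagCount (k + 2) .alpha else 0) -
      (b / ((a + b + n + k) * (a + b + n + k + 1))) • diagGen (k + 2) n a (b + k) z‖ ≤
      (3 * k * 2 ^ (k + 2) + 2 ^ (k + 2) * (1 + 3 * k * 2 ^ (k + 2))) /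
        ((a + b + n + k) * (a + b + n + k + 1)) := by
  have hb0 : 0 < b := by linarith
  have hy : b⁻¹ ≤ 1 := inv_le_one_of_one_le₀ hb
  have h1 := mean_hasAlpha (n := n + k + 1) ha hb0 ⟨n, by omega⟩
    (fun S => z ^ S.diagCount (k + 2) .alpha)
  simp only at h1
  rw [h1]
  have h2 := norm_freeGen_sub_le (n := n) ha hb hz (by omega : 2 ≤ k + 2) (by omega : k ≤ k + 2)
  have h3 := mean_rowFree_le (n := n) ha hb (by omega : 2 ≤ k + 2) (by omega : k ≤ k + 2)
  have hp : (1 : ℝ) ≤ 2 ^ k := one_le_pow₀ (by norm_num)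
  have hp2 : (2 : ℝ) ^ (k + 2) = 4 * 2 ^ k := by rw [pow_add]; ring
  -- Replacing `lowerFactor` by `1` costs a multiple of `b⁻¹` times the probability of a β-free row.
  -- That probability is of order `b / (a + b + n + k)`, so `b` cancels in `h6`.
  have h4 : ‖mean a b (fun S : StaircaseTableau (n + k + 1) => if S.RowFree n then
      S.lowerFactor ⟨n, by omega⟩ b⁻¹ • z ^ S.diagCount (k + 2) .alpha else 0) -
      freeGen (k + 2) n k a b z‖ ≤ 2 ^ (k + 2) * b⁻¹ *
      mean a b (fun S : StaircaseTableau (n + k + 1) => if S.RowFree n then (1 : ℝ) else 0) := by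
    rw [freeGen, ← mean_sub, ← smul_eq_mul _ (mean a b _), ← mean_const_smul]
    refine norm_mean_le ha hb0 fun S => ?_
    split_ifs
    · have e : S.lowerFactor ⟨n, by omega⟩ b⁻¹ • z ^ S.diagCount (k + 2) .alpha -
          z ^ S.diagCount (k + 2) .alpha =
          (S.lowerFactor ⟨n, by omega⟩ b⁻¹ - 1) • z ^ S.diagCount (k + 2) .alpha := by
        rw [sub_smul, one_smul]
      have hl := S.one_le_lowerFactor ⟨n, by omega⟩ (inv_nonneg.2 hb0.le)
      have hu := S.lowerFactor_le ⟨n, by omega⟩ (inv_nonneg.2 hb0.le)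
      have he : n + k + 1 - 1 - n = k := by omega
      simp only [he] at hu
      have hu' := one_add_pow_le (inv_nonneg.2 hb0.le) hy k
      rw [e, norm_smul, norm_pow, Real.norm_of_nonneg (by linarith), smul_eq_mul, mul_one]
      refine (mul_le_of_le_one_right (by linarith) (pow_le_one₀ (norm_nonneg _) hz)).trans ?_
      have : 0 ≤ b⁻¹ := by positivity
      nlinarith
    · simp
  set X := mean a b (fun S : StaircaseTableau (n + k + 1) => if S.RowFree n then
      S.lowerFactor ⟨n, by omega⟩ b⁻¹ • z ^ S.diagCount (k + 2) .alpha else 0)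
  have hD : 0 < a + b + n + k := by positivity
  have e0 : (a + b + (n + k + 1 : ℕ) : ℝ) = a + b + n + k + 1 := by push_cast; ring
  have e1 : (1 / (a + b + (n + k + 1 : ℕ)) : ℝ) • X -
      (b / ((a + b + n + k) * (a + b + n + k + 1))) • diagGen (k + 2) n a (b + k) z =
      (1 / (a + b + n + k + 1) : ℝ) • ((X - freeGen (k + 2) n k a b z) +
        (freeGen (k + 2) n k a b z - (b / (a + b + n + k)) • diagGen (k + 2) n a (b + k) z)) := by
    rw [e0, sub_add_sub_cancel, smul_sub, smul_smul]
    congr 2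
    field_simp
  rw [e1, norm_smul, Real.norm_of_nonneg (by positivity)]
  have h5 := (norm_add_le (X - freeGen (k + 2) n k a b z)
    (freeGen (k + 2) n k a b z - (b / (a + b + n + k)) • diagGen (k + 2) n a (b + k) z))
  have h6 : (2 : ℝ) ^ (k + 2) * b⁻¹ * ((b + 3 * k * 2 ^ (k + 2)) / (a + b + n + k)) ≤
      2 ^ (k + 2) * (1 + 3 * k * 2 ^ (k + 2)) / (a + b + n + k) := by
    rw [← mul_div_assoc, mul_assoc]
    refine div_le_div_of_nonneg_right (mul_le_mul_of_nonneg_left ?_ (by positivity)) hD.le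
    rw [mul_add, inv_mul_cancel₀ hb0.ne']
    have := mul_le_of_le_one_left (by positivity : (0 : ℝ) ≤ 3 * k * 2 ^ (k + 2)) hy
    linarith
  have h7 := mul_le_mul_of_nonneg_left h3 (by positivity : (0 : ℝ) ≤ 2 ^ (k + 2) * b⁻¹)
  have h8 : (3 * k * 2 ^ (k + 2) + 2 ^ (k + 2) * (1 + 3 * k * 2 ^ (k + 2))) /
        ((a + b + n + k) * (a + b + n + k + 1)) = 1 / (a + b + n + k + 1) *
      (2 ^ (k + 2) * (1 + 3 * k * 2 ^ (k + 2)) / (a + b + n + k) +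
        3 * k * 2 ^ (k + 2) / (a + b + n + k)) := by
    field_simp; ring
  rw [h8]
  refine mul_le_mul_of_nonneg_left ?_ (by positivity)
  linarith

theorem diagGen_succ (ha : 0 < a) (hb : 0 < b) (k : ℕ) :
    diagGen (k + 2) (n + k + 2) a b z = diagGen (k + 2) (n + k + 1) a (b + 1) z +
      (z - 1) * mean a b (fun S : StaircaseTableau (n + k + 1 + 1) =>
        if S.HasAlpha n then z ^ S.tail.diagCount (k + 2) .alpha else 0) := by
  rw [diagGen, diagGen, ← mean_tail ha hb, ← mean_const_mul, ← mean_add]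
  congr 1
  ext S
  rw [diagCount_succ]
  have h1 : k + 2 ≤ n + k + 1 + 1 := by omega
  have h2 : n + k + 1 + 1 - (k + 2) = n := by omega
  rw [h2]
  by_cases h : S.HasAlpha n
  · simp only [h, h1, and_self, if_true]; ring
  · simp [h]

/-- An approximate recursion for the generating function. -/
theorem norm_diagGen_sub_le (ha : 0 < a) (hb : 1 ≤ b) (hz : ‖z‖ ≤ 1) (k : ℕ) :
    ‖diagGen (k + 2) (n + k + 2) a b z - diagGen (k + 2) (n + k + 1) a (b + 1) z +
      (1 - z) * (b / ((a + b + n + k) * (a + b + n + k + 1)) : ℝ) *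
        diagGen (k + 2) n a (b + k) z‖ ≤
      2 * (3 * k * 2 ^ (k + 2) + 2 ^ (k + 2) * (1 + 3 * k * 2 ^ (k + 2))) /
        ((a + b + n + k) * (a + b + n + k + 1)) := by
  have h := norm_mean_hasAlpha_sub_le (n := n) ha hb hz k
  rw [Complex.real_smul] at h
  rw [diagGen_succ ha (by linarith)]
  refine le_trans (le_of_eq ?_) ((mul_le_mul_of_nonneg_left h (norm_nonneg (z - 1))).trans ?_)
  · rw [← norm_mul]; congr 1; ring
  · rw [mul_div_assoc]
    refine mul_le_mul_of_nonneg_right ?_ (by positivity)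
    refine (norm_sub_le _ _).trans ?_
    rw [norm_one]; linarith

/-- Needed once, to move from a possibly small `b` to `b + 1 ≥ 1`. -/
theorem norm_diagGen_sub_le_of_pos (ha : 0 < a) (hb : 0 < b) (hz : ‖z‖ ≤ 1) (k : ℕ) :
    ‖diagGen (k + 2) (n + k + 2) a b z - diagGen (k + 2) (n + k + 1) a (b + 1) z‖ ≤
      2 * ((b + 1 + 3 * k * 2 ^ (k + 2)) / (a + (b + 1) + n + k)) := by
  rw [diagGen_succ ha hb, add_sub_cancel_left, norm_mul]
  have h1 : ‖z - 1‖ ≤ 2 := (norm_sub_le _ _).trans (by rw [norm_one]; linarith)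
  have h2 : ‖mean a b (fun S : StaircaseTableau (n + k + 1 + 1) =>
        if S.HasAlpha n then z ^ S.tail.diagCount (k + 2) .alpha else 0)‖ ≤
      mean a b (fun S : StaircaseTableau (n + k + 1 + 1) =>
        if S.HasAlpha n then (1 : ℝ) else 0) := by
    refine norm_mean_le ha hb fun S => ?_
    split_ifs
    · rw [norm_pow]; exact pow_le_one₀ (norm_nonneg _) hz
    · simp
  have h3 := mean_hasAlpha_le (n := n + k + 1) ha hb ⟨n, by omega⟩
  have h4 := mean_rowFree_le (n := n) ha (by linarith : 1 ≤ b + 1) (by omega : 2 ≤ k + 2)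
    (by omega : k ≤ k + 2)
  exact mul_le_mul h1 (h2.trans (h3.trans h4)) (norm_nonneg _) (by norm_num)

end

end StaircaseTableau

/-! ### The limiting profile and the comparison by induction -/

namespace StaircaseTableau

noncomputable section

/-- The function `s ↦ exp (-(1 - z) / 2 * (1 - s))`. -/
def limitGen (z : ℂ) (s : ℝ) : ℂ := Complex.exp (-((1 - z) / 2) * (1 - s))

variable {z : ℂ}

theorem norm_half_one_sub_le (hz : ‖z‖ ≤ 1) : ‖(1 - z) / 2‖ ≤ 1 := by
  rw [norm_div, div_le_one (by simp)]
  refine (norm_sub_le _ _).trans ?_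
  simp; linarith

theorem norm_limitGen_le (hz : ‖z‖ ≤ 1) {s : ℝ} (hs : s ≤ 1) : ‖limitGen z s‖ ≤ 1 := by
  rw [limitGen, Complex.norm_exp, Real.exp_le_one_iff]
  have h1 : (-((1 - z) / 2) * (1 - (s : ℂ))) = ((1 - s : ℝ) : ℂ) * -((1 - z) / 2) := by
    push_cast; ring
  have h2 : (1 - z) / 2 = ((1 / 2 : ℝ) : ℂ) * (1 - z) := by push_cast; ring
  rw [h1, Complex.re_ofReal_mul, Complex.neg_re, h2, Complex.re_ofReal_mul, Complex.sub_re,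
    Complex.one_re]
  have h3 := (Complex.re_le_norm z).trans hz
  nlinarith [mul_nonneg (sub_nonneg.2 hs) (sub_nonneg.2 h3)]

theorem norm_limitGen_sub_le (hz : ‖z‖ ≤ 1) {s t : ℝ} (hs : s ≤ 1) (ht : t ≤ 1) :
    ‖limitGen z s - limitGen z t‖ ≤ |s - t| := by
  have hd : ∀ x ∈ Set.Iic (1 : ℝ), HasDerivWithinAt (limitGen z)
      (limitGen z x * ((1 - z) / 2)) (Set.Iic 1) x := by
    intro x _
    have h1 : HasDerivAt (fun s : ℝ => -((1 - z) / 2) * (1 - (s : ℂ))) ((1 - z) / 2) x := by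
      simpa using ((Complex.ofRealCLM.hasDerivAt (x := x)).const_sub 1).const_mul (-((1 - z) / 2))
    exact h1.cexp.hasDerivWithinAt
  have := (convex_Iic (1 : ℝ)).norm_image_sub_le_of_norm_hasDerivWithin_le (C := 1) hd
    (fun x hx => ?_) ht hs
  · simpa using this
  · rw [norm_mul]
    exact mul_le_one₀ (norm_limitGen_le hz hx) (norm_nonneg _) (norm_half_one_sub_le hz)

theorem abs_sq_sub_sq_le {s t : ℝ} (hs : 0 ≤ s) (hs1 : s ≤ 1) (ht : 0 ≤ t) (ht1 : t ≤ 1) :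
    |s ^ 2 - t ^ 2| ≤ 2 * |s - t| := by
  have h : s ^ 2 - t ^ 2 = (s + t) * (s - t) := by ring
  rw [h, abs_mul, abs_of_nonneg (by linarith : 0 ≤ s + t)]
  exact mul_le_mul_of_nonneg_right (by linarith) (abs_nonneg _)

/-- The limiting generating function satisfies the recursion up to a small error. -/
theorem norm_limitGen_recursion_le (hz : ‖z‖ ≤ 1) (k : ℕ) {b D : ℝ} (hb : 0 ≤ b)
    (hD : 1 ≤ D) (hbD : b + k ≤ D) :
    ‖limitGen z ((b / (D + 2)) ^ 2) - limitGen z (((b + 1) / (D + 2)) ^ 2) +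
      (1 - z) * (b / (D * (D + 1)) : ℝ) * limitGen z (((b + k) / D) ^ 2)‖ ≤
      (21 + 4 * k) / D ^ 2 := by
  have hk : (0 : ℝ) ≤ k := k.cast_nonneg
  have hD0 : 0 < D := by linarith
  have hs0 : 0 ≤ b / (D + 2) := by positivity
  have hs1 : b / (D + 2) ≤ 1 := by rw [div_le_one (by positivity)]; linarith
  have ht0 : 0 ≤ (b + k) / D := by positivity
  have ht1 : (b + k) / D ≤ 1 := by rw [div_le_one (by positivity)]; linarith
  set w := (1 - z) / 2 with hw
  have hw1 : ‖w‖ ≤ 1 := norm_half_one_sub_le hz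
  set f := limitGen z ((b / (D + 2)) ^ 2) with hf
  set g := limitGen z (((b + k) / D) ^ 2) with hg
  have hf1 : ‖f‖ ≤ 1 := norm_limitGen_le hz (pow_le_one₀ hs0 hs1)
  set d : ℝ := (2 * b + 1) / (D + 2) ^ 2 with hd
  have hd0 : 0 ≤ d := by positivity
  have hd1 : d ≤ 2 / D := by
    rw [hd, div_le_div_iff₀ (by positivity) hD0]
    nlinarith
  have hd2 : d ≤ 1 := by
    rw [hd, div_le_one (by positivity)]
    nlinarith
  have hwd : ‖w * d‖ ≤ d := by
    rw [norm_mul, Complex.norm_real, Real.norm_of_nonneg hd0]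
    exact mul_le_of_le_one_left hd0 hw1
  have hstep : limitGen z (((b + 1) / (D + 2)) ^ 2) = f * Complex.exp (w * d) := by
    rw [hf, limitGen, limitGen, ← Complex.exp_add]
    congr 1
    have : ((b + 1) / (D + 2)) ^ 2 = (b / (D + 2)) ^ 2 + d := by
      rw [hd]; field_simp; ring
    rw [this]
    push_cast
    ring
  have hz2 : 1 - z = 2 * w := by rw [hw]; ring
  -- With `d` the increment of the squared ratio, the four errors are: the Taylor remainder of
  -- `exp`, the part `1 / (D + 2) ^ 2` of `d`, the shift from `f` to `g`, and the change of
  -- denominator. Their constants add up to `4 + 1 + (4 * k + 8) + 8`.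
  have hsplit : f - limitGen z (((b + 1) / (D + 2)) ^ 2) +
      (1 - z) * (b / (D * (D + 1)) : ℝ) * g =
      -(f * (Complex.exp (w * d) - 1 - w * d)) + (-(f * w * (1 / (D + 2) ^ 2 : ℝ)) +
      (2 * w * (b / (D * (D + 1)) : ℝ) * (g - f) +
        2 * w * f * (b / (D * (D + 1)) - b / (D + 2) ^ 2 : ℝ))) := by
    have : d = 2 * (b / (D + 2) ^ 2) + 1 / (D + 2) ^ 2 := by rw [hd]; ring
    rw [hstep, hz2, this]
    push_cast
    ring
  have h1 : ‖-(f * (Complex.exp (w * d) - 1 - w * d))‖ ≤ 4 / D ^ 2 := by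
    rw [norm_neg, norm_mul]
    refine (mul_le_of_le_one_left (norm_nonneg _) hf1).trans ?_
    refine (Complex.norm_exp_sub_one_sub_id_le (hwd.trans hd2)).trans ?_
    calc ‖w * d‖ ^ 2 ≤ (2 / D) ^ 2 := pow_le_pow_left₀ (norm_nonneg _) (hwd.trans hd1) 2
      _ = 4 / D ^ 2 := by rw [div_pow]; norm_num
  have h2 : ‖-(f * w * (1 / (D + 2) ^ 2 : ℝ))‖ ≤ 1 / D ^ 2 := by
    rw [norm_neg, norm_mul, norm_mul, Complex.norm_real, Real.norm_of_nonneg (by positivity)]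
    refine (mul_le_of_le_one_left (by positivity) (mul_le_one₀ hf1 (norm_nonneg _) hw1)).trans ?_
    exact one_div_le_one_div_of_le (by positivity) (by nlinarith)
  have hbD1 : b / (D * (D + 1)) ≤ 1 / D := by
    rw [div_le_div_iff₀ (by positivity) hD0]
    nlinarith
  have h3 : ‖2 * w * (b / (D * (D + 1)) : ℝ) * (g - f)‖ ≤ (4 * k + 8) / D ^ 2 := by
    have hgf : ‖g - f‖ ≤ 2 * ((k + 2) / D) := by
      refine (norm_limitGen_sub_le hz (pow_le_one₀ ht0 ht1) (pow_le_one₀ hs0 hs1)).trans ?_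
      refine (abs_sq_sub_sq_le ht0 ht1 hs0 hs1).trans ?_
      refine mul_le_mul_of_nonneg_left ?_ (by norm_num)
      have e : (b + k) / D - b / (D + 2) = (k + 2 * (b / (D + 2))) / D := by
        field_simp; ring
      rw [e, abs_of_nonneg (by positivity)]
      exact div_le_div_of_nonneg_right (by linarith) hD0.le
    rw [norm_mul, norm_mul, norm_mul, Complex.norm_real, Real.norm_of_nonneg (by positivity),
      Complex.norm_ofNat]
    calc 2 * ‖w‖ * (b / (D * (D + 1))) * ‖g - f‖ ≤ 2 * 1 * (1 / D) * (2 * ((k + 2) / D)) := by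
          gcongr
      _ = (4 * k + 8) / D ^ 2 := by field_simp; ring
  have h4 : ‖2 * w * f * (b / (D * (D + 1)) - b / (D + 2) ^ 2 : ℝ)‖ ≤ 8 / D ^ 2 := by
    have e : b / (D * (D + 1)) - b / (D + 2) ^ 2 = b * (3 * D + 4) / (D * (D + 1) * (D + 2) ^ 2) := by
      field_simp; ring
    have hle : b * (3 * D + 4) / (D * (D + 1) * (D + 2) ^ 2) ≤ 4 / D ^ 2 := by
      rw [div_le_div_iff₀ (by positivity) (by positivity)]
      calc b * (3 * D + 4) * D ^ 2 ≤ (D + 2) * (4 * (D + 1)) * (D * (D + 2)) := by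
            have h1 : b ≤ D + 2 := by linarith
            have h2 : 3 * D + 4 ≤ 4 * (D + 1) := by linarith
            have h3 : D ^ 2 ≤ D * (D + 2) := by nlinarith
            gcongr
        _ = 4 * (D * (D + 1) * (D + 2) ^ 2) := by ring
    rw [e, norm_mul, norm_mul, norm_mul, Complex.norm_real, Real.norm_of_nonneg (by positivity),
      Complex.norm_ofNat]
    calc 2 * ‖w‖ * ‖f‖ * (b * (3 * D + 4) / (D * (D + 1) * (D + 2) ^ 2)) ≤
        2 * 1 * 1 * (4 / D ^ 2) := by gcongr
      _ = 8 / D ^ 2 := by ring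
  rw [hsplit]
  refine (norm_add_le _ _).trans ((add_le_add h1 ((norm_add_le _ _).trans (add_le_add h2
    ((norm_add_le _ _).trans (add_le_add h3 h4))))).trans_eq ?_)
  ring

theorem exp_neg_le_one_sub_half {x : ℝ} (hx : 0 ≤ x) (hx1 : x ≤ 1) : Real.exp (-x) ≤ 1 - x / 2 := by
  have h := Real.add_one_le_exp x
  have h1 : Real.exp (-x) * Real.exp x = 1 := by rw [← Real.exp_add]; simp
  have h2 := Real.exp_pos (-x)
  nlinarith

/-- The constant in the approximate recursion for the generating function. -/
def recursionConst (k : ℕ) : ℝ :=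
  2 * (3 * k * 2 ^ (k + 2) + 2 ^ (k + 2) * (1 + 3 * k * 2 ^ (k + 2)))

theorem recursionConst_nonneg (k : ℕ) : 0 ≤ recursionConst k := by
  unfold recursionConst; positivity

theorem norm_one_sub_mul_le (hz : ‖z‖ ≤ 1) {b D : ℝ} (hb : 0 ≤ b) (hD : 0 < D) (hbD : b ≤ D) :
    ‖(1 - z) * (b / (D * (D + 1)) : ℝ)‖ ≤ 2 / D := by
  rw [norm_mul, Complex.norm_real, Real.norm_of_nonneg (by positivity)]
  have h1 : ‖1 - z‖ ≤ 2 := (norm_sub_le _ _).trans (by rw [norm_one]; linarith)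
  have h2 : b / (D * (D + 1)) ≤ 1 / D := by
    rw [div_le_div_iff₀ (by positivity) hD]
    nlinarith
  calc ‖1 - z‖ * (b / (D * (D + 1))) ≤ 2 * (1 / D) := by gcongr
    _ = 2 / D := by ring

/-- The induction step in isolation. In units of `K * E / (D + 2) ^ 2`, the shrinking of the
exponential weight gains `27 / 2`, while the term with `c` loses at most 4 and the two residuals at
most 2. -/
theorem norm_sub_le_of_recursion {p p₁ p₂ q q₁ q₂ c : ℂ} {D K E C₁ C₂ : ℝ} (hD1 : 52 ≤ D)
    (hK0 : 0 ≤ K) (hC0 : 0 ≤ C₁ + C₂) (hCK : C₁ + C₂ ≤ K) (hE : 1 ≤ E) (hc : ‖c‖ ≤ 2 / D)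
    (h₁ : ‖p₁ - q₁‖ ≤ K / (D + 2) * (E * (1 - 27 / (D + 2) / 2))) (h₂ : ‖p₂ - q₂‖ ≤ K / D * E)
    (hp : ‖p - p₁ + c * p₂‖ ≤ C₁ / D ^ 2) (hq : ‖q - q₁ + c * q₂‖ ≤ C₂ / D ^ 2) :
    ‖p - q‖ ≤ K / (D + 2) * E := by
  have hD0 : 0 < D := by linarith
  have hKE : 0 ≤ K * E := by positivity
  have hsplit : p - q = (p₁ - q₁) - c * (p₂ - q₂) +
      ((p - p₁ + c * p₂) - (q - q₁ + c * q₂)) := by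
    ring
  have hD2 : 1 / D ^ 2 ≤ 2 / (D + 2) ^ 2 := by
    rw [div_le_div_iff₀ (by positivity) (by positivity)]
    nlinarith
  have j1 : K / (D + 2) * (E * (1 - 27 / (D + 2) / 2)) =
      K / (D + 2) * E - 27 / 2 * (K * E / (D + 2) ^ 2) := by
    field_simp
  have j2 : ‖c * (p₂ - q₂)‖ ≤ 4 * (K * E / (D + 2) ^ 2) := by
    rw [norm_mul]
    calc ‖c‖ * ‖p₂ - q₂‖ ≤ 2 / D * (K / D * E) :=
          mul_le_mul hc h₂ (norm_nonneg _) (by positivity)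
      _ = 2 * (K * E) * (1 / D ^ 2) := by field_simp
      _ ≤ 2 * (K * E) * (2 / (D + 2) ^ 2) := mul_le_mul_of_nonneg_left hD2 (by positivity)
      _ = _ := by ring
  have j3 : ‖(p - p₁ + c * p₂) - (q - q₁ + c * q₂)‖ ≤ 2 * (K * E / (D + 2) ^ 2) := by
    refine (norm_sub_le _ _).trans ?_
    calc _ ≤ (C₁ + C₂) * (1 / D ^ 2) := (add_le_add hp hq).trans_eq (by ring)
      _ ≤ (C₁ + C₂) * (2 / (D + 2) ^ 2) := mul_le_mul_of_nonneg_left hD2 hC0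
      _ ≤ (K * E) * (2 / (D + 2) ^ 2) :=
        mul_le_mul_of_nonneg_right (hCK.trans (le_mul_of_one_le_right hK0 hE)) (by positivity)
      _ = _ := by ring
  rw [hsplit]
  refine (norm_add_le _ _).trans ((add_le_add (norm_sub_le _ _) le_rfl).trans ?_)
  have hfin : 0 ≤ K * E / (D + 2) ^ 2 := by positivity
  linarith

/-- A discrete Gronwall argument by strong induction on `n`. The main step preserves `a + b + n` and
lowers `n` by one, so the exponential weight shrinks enough to absorb the local errors. -/
theorem norm_diagGen_sub_limitGen_le (k : ℕ) (M : ℝ) (hM : 0 ≤ M) :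
    ∃ K, 0 ≤ K ∧ ∀ (z : ℂ) (a : ℝ), ‖z‖ ≤ 1 → 0 < a → a ≤ M → ∀ (n : ℕ) (b : ℝ), 1 ≤ b →
      ‖diagGen (k + 2) n a b z - limitGen z ((b / (a + b + n)) ^ 2)‖ ≤
        K / (a + b + n) * Real.exp (27 * (n / (a + b + n))) := by
  have hC := recursionConst_nonneg k
  have hk : (0 : ℝ) ≤ k := k.cast_nonneg
  set C := recursionConst k + (21 + 4 * k) with hCdef
  have hC0 : 0 ≤ C := by positivity
  -- `108 = 2 * 54` makes the bound trivial when `a + b + n ≤ 54`, `C` dominates the residuals, and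
  -- the last term covers `n < k + 2`, where the diagonal is empty.
  set K := 108 + C + 2 * (k + 2 + M) with hK
  have hK0 : 0 ≤ K := by positivity
  refine ⟨K, hK0, fun z a hz ha haM n => ?_⟩
  induction n using Nat.strong_induction_on with
  | _ n ih =>
  intro b hb
  have hb0 : 0 < b := by linarith
  have hn : (0 : ℝ) ≤ n := n.cast_nonneg
  have hN : 0 < a + b + n := by positivity
  have hs0 : 0 ≤ b / (a + b + n) := by positivity
  have hs1 : b / (a + b + n) ≤ 1 := by rw [div_le_one hN]; linarith
  have hE : 1 ≤ Real.exp (27 * (n / (a + b + n))) := Real.one_le_exp (by positivity)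
  have hKN : 0 ≤ K / (a + b + n) := by positivity
  have hcoarse : ∀ x, x ≤ K / (a + b + n) → x ≤ K / (a + b + n) *
      Real.exp (27 * (n / (a + b + n))) :=
    fun x hx => hx.trans (le_mul_of_one_le_right hKN hE)
  by_cases hnk : n < k + 2
  · refine hcoarse _ ?_
    rw [diagGen_eq_one ha hb0 hnk]
    have h1 : limitGen z 1 = 1 := by simp [limitGen]
    have h2 := norm_limitGen_sub_le hz le_rfl (pow_le_one₀ (n := 2) hs0 hs1)
    rw [h1] at h2
    refine h2.trans ?_
    have h3 := abs_sq_sub_sq_le zero_le_one le_rfl hs0 hs1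
    rw [one_pow] at h3
    refine h3.trans ?_
    have e : 1 - b / (a + b + n) = (a + n) / (a + b + n) := by field_simp; ring
    rw [e, abs_of_nonneg (by positivity), ← mul_div_assoc]
    refine div_le_div_of_nonneg_right ?_ hN.le
    have : (n : ℝ) < k + 2 := by exact_mod_cast hnk
    linarith
  obtain ⟨m, rfl⟩ : ∃ m, n = m + k + 2 := ⟨n - (k + 2), by omega⟩
  by_cases hN54 : a + b + (m + k + 2 : ℕ) ≤ 54
  · refine hcoarse _ ?_
    have h1 := norm_diagGen_le ha hb0 hz (k + 2) (m + k + 2)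
    have h2 := norm_limitGen_le hz (pow_le_one₀ (n := 2) hs0 hs1)
    refine (norm_sub_le _ _).trans ((add_le_add h1 h2).trans ?_)
    rw [le_div_iff₀ hN]
    linarith
  set D := a + b + m + k with hD
  have hm : (0 : ℝ) ≤ m := m.cast_nonneg
  have hND : a + b + (m + k + 2 : ℕ) = D + 2 := by push_cast; ring
  rw [hND] at hN54 hs0 hs1 hKN hE hN ⊢
  have hD1 : 52 ≤ D := by linarith
  have hD0 : 0 < D := by linarith
  have i1 := ih (m + k + 1) (by omega) (b + 1) (by linarith)
  have i2 := ih m (by omega) (b + k) (by linarith)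
  have e1 : a + (b + 1) + (m + k + 1 : ℕ) = D + 2 := by push_cast; ring
  have e2 : a + (b + k) + m = D := by ring
  rw [e1] at i1
  rw [e2] at i2
  have r1 := norm_diagGen_sub_le (n := m) ha hb hz k
  have r2 := norm_limitGen_recursion_le hz k hb0.le (by linarith : 1 ≤ D) (by linarith : b + k ≤ D)
  rw [← hD, ← recursionConst] at r1
  set E := Real.exp (27 * ((m + k + 2 : ℕ) / (D + 2))) with hEdef
  have hE1 : Real.exp (27 * ((m + k + 1 : ℕ) / (D + 2))) ≤ E * (1 - 27 / (D + 2) / 2) := by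
    have e : 27 * (((m + k + 1 : ℕ) : ℝ) / (D + 2)) =
        27 * ((m + k + 2 : ℕ) / (D + 2)) + -(27 / (D + 2)) := by push_cast; ring
    rw [e, Real.exp_add]
    refine mul_le_mul_of_nonneg_left (exp_neg_le_one_sub_half (by positivity) ?_) (by positivity)
    rw [div_le_one (by positivity)]
    linarith
  have hE2 : Real.exp (27 * (m / D)) ≤ E := by
    refine Real.exp_le_exp.2 (mul_le_mul_of_nonneg_left ?_ (by norm_num))
    rw [div_le_div_iff₀ hD0 hN]
    push_cast
    nlinarith
  have hDD : D ^ 2 ≤ D * (D + 1) := by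
    rw [sq]; exact mul_le_mul_of_nonneg_left (by linarith) hD0.le
  have hc1 : ‖(1 - z) * (b / (D * (D + 1)) : ℝ)‖ ≤ 2 / D :=
    norm_one_sub_mul_le hz hb0.le hD0 (by linarith)
  refine norm_sub_le_of_recursion (by linarith) hK0 hC0 (by linarith) hE hc1
    (i1.trans (mul_le_mul_of_nonneg_left hE1 hKN))
    (i2.trans (mul_le_mul_of_nonneg_left hE2 (by positivity)))
    (r1.trans (div_le_div_of_nonneg_left hC (by positivity) hDD)) r2

/-- One crude step reaches `b + 1 ≥ 1`; the profile is then evaluated at a squared ratio of at most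
`(M + 1) / (n + 1)`, close to `0`. Uniformity in `a` and `b` is what infinite parameters require. -/
theorem norm_diagGen_sub_exp_le (k : ℕ) (M : ℝ) (hM : 0 ≤ M) :
    ∃ K, ∀ (z : ℂ) (a b : ℝ), ‖z‖ ≤ 1 → 0 < a → a ≤ M → 0 < b → b ≤ M → ∀ n : ℕ,
      ‖diagGen (k + 2) (n + k + 2) a b z - Complex.exp (-((1 - z) / 2))‖ ≤ K / (n + 1) := by
  obtain ⟨K, hK0, hK⟩ := norm_diagGen_sub_limitGen_le k M hM
  refine ⟨2 * (M + 1 + 3 * k * 2 ^ (k + 2)) + (K * Real.exp 27 + (M + 1)),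
    fun z a b hz ha haM hb hbM n => ?_⟩
  have hk : (0 : ℝ) ≤ k := k.cast_nonneg
  have hn : (0 : ℝ) ≤ n := n.cast_nonneg
  have h1 := norm_diagGen_sub_le_of_pos (n := n) ha hb hz k
  have h2 := hK z a hz ha haM (n + k + 1) (b + 1) (by linarith)
  set N := a + (b + 1) + (n + k + 1 : ℕ) with hN
  have hN1 : (n : ℝ) + 1 ≤ N := by rw [hN]; push_cast; linarith
  have hN0 : 0 < N := by linarith
  have hs0 : 0 ≤ (b + 1) / N := by positivity
  have hs1 : (b + 1) / N ≤ 1 := by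
    rw [div_le_one hN0, hN]; push_cast; linarith
  have h3 := norm_limitGen_sub_le hz (pow_le_one₀ (n := 2) hs0 hs1) zero_le_one
  have e0 : limitGen z 0 = Complex.exp (-((1 - z) / 2)) := by simp [limitGen]
  rw [e0] at h3
  have b1 : 2 * ((b + 1 + 3 * k * 2 ^ (k + 2)) / (a + (b + 1) + n + k)) ≤
      2 * (M + 1 + 3 * k * 2 ^ (k + 2)) / (n + 1) := by
    rw [mul_div_assoc]
    refine mul_le_mul_of_nonneg_left ?_ (by norm_num)
    exact div_le_div₀ (by positivity) (by linarith) (by positivity) (by linarith)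
  have b2 : K / N * Real.exp (27 * ((n + k + 1 : ℕ) / N)) ≤ K * Real.exp 27 / (n + 1) := by
    rw [mul_div_right_comm]
    refine mul_le_mul (div_le_div_of_nonneg_left hK0 (by positivity) hN1) ?_ (by positivity)
      (by positivity)
    refine Real.exp_le_exp.2 ?_
    have : ((n + k + 1 : ℕ) : ℝ) / N ≤ 1 := by rw [div_le_one hN0, hN]; linarith
    linarith
  have b3 : |((b + 1) / N) ^ 2 - 0| ≤ (M + 1) / (n + 1) := by
    rw [sub_zero, abs_of_nonneg (by positivity), sq]
    refine (mul_le_of_le_one_left hs0 hs1).trans ?_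
    exact div_le_div₀ (by positivity) (by linarith) (by positivity) hN1
  refine (norm_sub_le_norm_sub_add_norm_sub _ _ _).trans ((add_le_add (h1.trans b1)
    ((norm_sub_le_norm_sub_add_norm_sub _ _ _).trans
      (add_le_add (h2.trans b2) (h3.trans b3)))).trans_eq ?_)
  ring

end

end StaircaseTableau

/-! ### From characteristic functions to convergence in law on `ℕ` -/

/-- Lévy's theorem gives convergence of the laws on `ℝ`. Every open set of `ℕ` is the preimage of an
open set of `ℝ`, so the portmanteau inequality for open sets pulls back. -/
theorem tendstoInDistribution_nat_of_charFun {Ω : ℕ → Type*} {m : ∀ i, MeasurableSpace (Ω i)}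
    {μ : (i : ℕ) → MeasureTheory.Measure (Ω i)} [∀ i, MeasureTheory.IsProbabilityMeasure (μ i)]
    {ν : MeasureTheory.Measure ℕ} [MeasureTheory.IsProbabilityMeasure ν] {X : (i : ℕ) → Ω i → ℕ}
    (hX : ∀ i, AEMeasurable (X i) (μ i))
    (h : ∀ t : ℝ, Filter.Tendsto
      (fun i => MeasureTheory.charFun ((μ i).map fun ω => (X i ω : ℝ)) t) Filter.atTop
      (nhds (MeasureTheory.charFun (ν.map (Nat.cast : ℕ → ℝ)) t))) :
    MeasureTheory.TendstoInDistribution X Filter.atTop (id : ℕ → ℕ) μ ν where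
  forall_aemeasurable := hX
  aemeasurable_limit := aemeasurable_id
  tendsto := by
    have hcast : Measurable (Nat.cast : ℕ → ℝ) := measurable_from_nat
    have hX' : ∀ i, AEMeasurable (fun ω => (X i ω : ℝ)) (μ i) := fun i =>
      hcast.comp_aemeasurable (hX i)
    let P : ℕ → MeasureTheory.ProbabilityMeasure ℝ := fun i =>
      ⟨(μ i).map fun ω => (X i ω : ℝ), MeasureTheory.Measure.isProbabilityMeasure_map (hX' i)⟩
    let Q : MeasureTheory.ProbabilityMeasure ℝ :=
      ⟨ν.map Nat.cast, MeasureTheory.Measure.isProbabilityMeasure_map hcast.aemeasurable⟩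
    have hP : Filter.Tendsto P Filter.atTop (nhds Q) :=
      MeasureTheory.ProbabilityMeasure.tendsto_of_tendsto_charFun h
    refine MeasureTheory.tendsto_of_forall_isOpen_le_liminf' fun G hG => ?_
    obtain ⟨U, hU, rfl⟩ := Nat.isClosedEmbedding_coe_real.isInducing.isOpen_iff.1 hG
    have hle := MeasureTheory.ProbabilityMeasure.le_liminf_measure_open_of_tendsto hP hU
    have hQ : (Q : MeasureTheory.Measure ℝ) U = ν.map id (Nat.cast ⁻¹' U) := by
      rw [MeasureTheory.Measure.map_id]
      exact MeasureTheory.Measure.map_apply hcast hU.measurableSet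
    have hPi : ∀ i, (P i : MeasureTheory.Measure ℝ) U = (μ i).map (X i) (Nat.cast ⁻¹' U) := by
      intro i
      rw [MeasureTheory.Measure.map_apply_of_aemeasurable (hX i) (hcast hU.measurableSet)]
      exact MeasureTheory.Measure.map_apply_of_aemeasurable (hX' i) hU.measurableSet
    simp only [hQ, hPi] at hle
    exact hle

/-! ### Infinite parameters and the conclusion -/

namespace StaircaseTableau

noncomputable section

variable {n : ℕ}

open Finset

theorem coe_weight (α β : ℝ≥0) (S : StaircaseTableau n) :
    (S.weight α β : ℝ) = S.boxProd α β := by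
  classical
  have hcard : ∀ x, S.count x = (univ.filter fun p : Fin n × Fin n =>
      S.entry p.2 p.1 = some x).card := by
    intro x
    rw [count, Set.ncard_eq_toFinset_card', ← Finset.card_map (Equiv.prodComm _ _).toEmbedding]
    congr 1
    ext ⟨i, j⟩
    simp
  have hbox : ∀ e : Option StairSymbol, boxWeight α β e =
      (if e = some .alpha then (α : ℝ) else 1) * if e = some .beta then (β : ℝ) else 1 := by
    rintro (_ | _ | _) <;> simp [boxWeight]
  rw [weight, boxProd, ← Fintype.prod_prod_type' (f := fun j i => boxWeight α β (S.entry i j)),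
    hcard, hcard]
  simp only [hbox, Finset.prod_mul_distrib, Finset.prod_ite, Finset.prod_const, one_pow,
    mul_one]
  push_cast
  rfl

theorem sum_prob_smul (α β : ℝ≥0) (F : StaircaseTableau n → ℂ) :
    ∑ S : StaircaseTableau n, (S.prob α β : ℝ) • F S = mean (α : ℝ)⁻¹ (β : ℝ)⁻¹ F := by
  simp only [mean, boxSum, inv_inv, Finset.smul_sum, smul_smul, prob, partitionFunction]
  refine Finset.sum_congr rfl fun S _ => ?_
  push_cast
  simp only [coe_weight, div_eq_inv_mul]

theorem eventually_inv_param {x : ℝ≥0∞} (hx : x ≠ 0) :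
    ∀ᶠ t : ℝ≥0 in Filter.atTop, 0 < ((param x t : ℝ≥0) : ℝ)⁻¹ ∧
      ((param x t : ℝ≥0) : ℝ)⁻¹ ≤ x.toReal⁻¹ + 1 := by
  filter_upwards [Filter.eventually_ge_atTop 1] with t ht
  have h := param_ne_zero hx (zero_lt_one.trans_le ht)
  refine ⟨by positivity, ?_⟩
  -- For `x = ∞` the convention `toReal ∞ = 0` reduces the bound to `t⁻¹ ≤ 1`.
  by_cases h' : x = ∞
  · simpa [param, h'] using inv_le_one_of_one_le₀ (by exact_mod_cast ht : (1 : ℝ) ≤ t)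
  · simp [param, h', ENNReal.toReal]

/-- At a fixed size the sum is a finite limit in `t`, and the bound for finite parameters does not
depend on `t`, so it passes to the limit. -/
theorem exists_norm_sum_extProb_sub_exp_le (k : ℕ) {α β : ℝ≥0∞} (hα : α ≠ 0) (hβ : β ≠ 0) :
    ∃ K : ℝ, ∀ z : ℂ, ‖z‖ ≤ 1 → ∀ n : ℕ,
      ‖∑ S : StaircaseTableau (n + k + 2), (S.extProb α β : ℝ) • z ^ S.diagCount (k + 2) .alpha -
        Complex.exp (-((1 - z) / 2))‖ ≤ K / (n + 1) := by
  have hA : 0 ≤ α.toReal⁻¹ := by positivity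
  have hB : 0 ≤ β.toReal⁻¹ := by positivity
  obtain ⟨K, hK⟩ := norm_diagGen_sub_exp_le k (α.toReal⁻¹ + β.toReal⁻¹ + 1) (by positivity)
  refine ⟨K, fun z hz n => ?_⟩
  have hlim : Filter.Tendsto (fun t : ℝ≥0 => ∑ S : StaircaseTableau (n + k + 2),
      (S.prob (param α t) (param β t) : ℝ) • z ^ S.diagCount (k + 2) .alpha) Filter.atTop
      (nhds (∑ S : StaircaseTableau (n + k + 2),
        (S.extProb α β : ℝ) • z ^ S.diagCount (k + 2) .alpha)) :=
    tendsto_finsetSum _ fun S _ => (NNReal.tendsto_coe.2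
      (tendsto_prob_param α β (Or.inl hα) S)).smul_const _
  refine le_of_tendsto (hlim.sub_const _).norm ?_
  filter_upwards [eventually_inv_param hα, eventually_inv_param hβ] with t h1 h2
  rw [sum_prob_smul]
  exact hK z _ _ hz h1.1 (by linarith [h1.2]) h2.1 (by linarith [h2.2]) n

theorem charFun_law_diagCount (k : ℕ) (α β : ℝ≥0∞) (h : α ≠ 0 ∨ β ≠ 0) (t : ℝ) :
    MeasureTheory.charFun ((law n α β h).toMeasure.map
      fun S => (S.diagCount k .alpha : ℝ)) t =
    ∑ S : StaircaseTableau n,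
      (S.extProb α β : ℝ) • Complex.exp (t * Complex.I) ^ S.diagCount k .alpha := by
  rw [MeasureTheory.charFun_apply_real, MeasureTheory.integral_map
    (Measurable.of_discrete).aemeasurable (by fun_prop), PMF.integral_eq_sum]
  refine Finset.sum_congr rfl fun S _ => ?_
  rw [← Complex.exp_nat_mul]
  congr 2
  push_cast
  ring

end

end StaircaseTableau

theorem theorem4p2 (k : ℕ) (hk : 1 < k) (α β : ℝ≥0∞) (hα : α ≠ 0) (hβ : β ≠ 0) :
    MeasureTheory.TendstoInDistribution
      (fun (n : ℕ) (S : StaircaseTableau n) => S.diagCount k StairSymbol.alpha)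
      Filter.atTop
      (id : ℕ → ℕ)
      (fun n : ℕ => (StaircaseTableau.law n α β (Or.inl hα)).toMeasure)
      (ProbabilityTheory.poissonMeasure (1 / 2)) := by
  obtain ⟨k, rfl⟩ : ∃ m, k = m + 2 := ⟨k - 2, by omega⟩
  refine tendstoInDistribution_nat_of_charFun (fun n => Measurable.of_discrete.aemeasurable)
    fun t => ?_
  obtain ⟨K, hK⟩ := StaircaseTableau.exists_norm_sum_extProb_sub_exp_le k hα hβ
  simp only [StaircaseTableau.charFun_law_diagCount]
  -- With `k` already lowered by two, `k + 2` is the first size at which the diagonal is nonempty;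
  -- the estimates start there.
  rw [ProbabilityTheory.charFun_map_cast_poissonMeasure, ← Filter.tendsto_add_atTop_iff_nat (k + 2),
    tendsto_iff_norm_sub_tendsto_zero]
  refine squeeze_zero (fun _ => norm_nonneg _) (fun n => ?_)
    (g := fun n : ℕ => K * (1 / ((n : ℝ) + 1))) ?_
  · have h := hK (Complex.exp (t * Complex.I)) (Complex.norm_exp_ofReal_mul_I t).le n
    rw [mul_one_div]
    have e : ((1 / 2 : ℝ≥0) : ℂ) * (Complex.exp (t * Complex.I) - 1) =
        -((1 - Complex.exp (t * Complex.I)) / 2) := by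
      push_cast; ring
    exact e ▸ h
  · simpa using (tendsto_one_div_add_atTop_nhds_zero_nat (𝕜 := ℝ)).const_mul K
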